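/- Fix integers $k\ge 2$ (topics) and $V$ (vocabulary size). Let $\Delta^{m-1}\subset\mathbb R^m$ be the probability simplex, $\mathbf e_1,\dots,\mathbf e_k$ the standard basis of $\mathbb R^k$, $\mathbf 1$ the all-ones vector, and write $a\vee b=\max(a,b)$. **Model and estimator.** Let $C^0\in\mathbb R^{V\times k}$ be column-stochastic (its columns lie in $\Delta^{V-1}$), and let $P^0$ be a probability distribution on $\Delta^{k-1}$. The columns $w_1,\dots,w_d$ of $W^0\in\mathbb R^{k\times d}$ are i.i.d. from $P^0$; given $W^0$, the documents $1,\dots,d$ are independent, and the $n$ words of document $i$, $x^{(i)}=(x_{i,1},\dots,x_{i,n})$, are i.i.d. from the categorical distribution on $\{1,\dots,V\}$ with probability vector $C^0w_i$. With $f_n(x\mid u)=\prod_{j=1}^n u_{x_j}$, the estimator $\hat C_n$ is any maximizer, over all column-stochastic $V\times k$ matrices $C$, of the integrated likelihood $$F(C;X)=\prod_{i=1}^d\int_{\Delta^{k-1}} f_n(x^{(i)}\mid Cw)\,d\mathrm{Unif}(w),$$ where $\mathrm{Unif}$ is the uniform distribution on $\Delta^{k-1}$ (so the $i$-th factor is the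 average of $f_n(x^{(i)}\mid\cdot)$ over $\mathrm{conv}(C)$ when the columns of $C$ are affinely independent). Let $\mathrm{dis}(C,\bar C)=\min_\Pi\|\bar C-C\Pi\|_2$, with the spectral norm and $\Pi$ ranging over the $k\times k$ permutation matrices. **$(\alpha,\beta)$-SS.** Let $\mathcal K=\{x\in\mathbb R^k:\|x\|_2\le x^T\mathbf 1\}$. For $\alpha,\beta\ge0$ a matrix $W$ with $k$ rows is $(\alpha,\beta)$-SS if (S1) $\{x: x^TW\ge 0\}\subseteq\mathcal K$, and (S3) every $x\in\mathbb R^k$ with $x^TW\ge-\alpha\|x\|_2$ (entrywise) and $\big|\|x\|_2-x^T\mathbf 1\big|\le\alpha\|x\|_2$ satisfies $\|x-\lambda\mathbf e_f\|_2\le\beta\lambda$ for some $f\in\{1,\dots,k\}$ and $\lambda\ge 0$. The distribution $P^0$ is $(\alpha,\beta)$-SS with $s$ points and constants $r_0,c_0>0$ if there are $s$ distinct points $w^\sharp_1,\dots,w^\sharp_s$ in its support such that the matrix with these columns is $(\alpha,\beta)$-SS and $P^0(\|w-w^\sharp_i\|_2\le r)\ge (k-1)!\,c_0\,r^{k-1}$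 for all $i$ and $0<r\le r_0$. **Assumptions.** (A1) $C^0$ has rank $k$ and its entries are bounded below by a positive constant. (A2) (with constants $l,\sigma>0$) With $W_c=W^0-\frac1dW^0\mathbf 1_d\mathbf 1_d^T$, the $k-1$ eigenvalues of $\frac1dW_cW_c^T$ on the orthogonal complement of $\mathbf 1_k$ are at least $l$; and $W^0$ has $k$ affinely independent columns that form a matrix with all singular values at least $\sigma$. (A5) (with a constant $C_1'$) $P^0$ is $(\alpha,\beta)$-SS with $s$ points and constants $r_0,c_0$, where $$\alpha\ \ge\ C_1'\left(\sqrt{\tfrac{\log(n\vee d)}{n}}+\left(\tfrac{\log d}{d}\right)^{\frac1{k-1}}\right).$$ **Theorem.** Let $C^0$ satisfy (A1) and let $l,\sigma,r_0,c_0>0$. There are positive constants $c,C_1',D_1',D_2',D_3',D_4'$, depending only on $k,V,C^0,l,\sigma,r_0,c_0$, such that for all $n,d\ge1$, all $s$, all $\alpha,\beta\ge 0$ and all $P^0$ satisfying (A5), with probability at least $1-D_1's/d-D_2'd/(n\vee d)^c$, if $W^0$ satisfies (A2), then $$\mathrm{dis}(\hat C_n,C^0)\ \le\ D_3'\sqrt{\tfrac{\log(n\vee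 d)}{n}}+D_4'\beta .$$ In particular, for every constant $C_2'>0$ there are positive constants $D_3'',D_4''$, depending only on $C_2'$ and the quantities above, such that if in addition $\beta\le C_2'\big(\sqrt{\log(n\vee d)/n}+(\log d/d)^{1/(k-1)}\big)$, then, with probability at least $1-D_1's/d-D_2'd/(n\vee d)^c$, if $W^0$ satisfies (A2), $$\mathrm{dis}(\hat C_n,C^0)\ \le\ D_3''\sqrt{\tfrac{\log(n\vee d)}{n}}+D_4''\left(\tfrac{\log d}{d}\right)^{\frac1{k-1}} .$$ -/

import Mathlib

open MeasureTheory
open scoped Matrix MeasureTheory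

noncomputable section

namespace TopicModel

/-! Geometry of the simplex and of the second order cone. -/

/-- The probability simplex `Δ^{k-1}`, inside `ℝ^k` with its Euclidean norm. -/
def simplex (k : ℕ) : Set (EuclideanSpace ℝ (Fin k)) :=
  {w | (∀ j, 0 ≤ w j) ∧ ∑ j, w j = 1}

/-- `cone(W) = {W l : l ≥ 0}`, for the matrix `W` with columns `w i`. -/
def cone {k s : ℕ} (w : Fin s → EuclideanSpace ℝ (Fin k)) : Set (EuclideanSpace ℝ (Fin k)) :=
  {x | ∃ l : Fin s → ℝ, (∀ i, 0 ≤ l i) ∧ x = ∑ i, l i • w i}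

/-- The dual cone `S* = {x : xᵀ y ≥ 0 for all y in S}`. -/
def dualCone {k : ℕ} (S : Set (EuclideanSpace ℝ (Fin k))) : Set (EuclideanSpace ℝ (Fin k)) :=
  {x | ∀ y ∈ S, 0 ≤ inner ℝ x y}

/-- The second order cone `K = {x : ‖x‖₂ ≤ xᵀ 1}`. -/
def secondOrderCone (k : ℕ) : Set (EuclideanSpace ℝ (Fin k)) :=
  {x | ‖x‖ ≤ ∑ j, x j}

/-- The `α`-enlargement `[cone(W)*]^α = {x : xᵀ W ≥ -α ‖x‖₂}`. -/
def dualConeEnlarged {k s : ℕ} (w : Fin s → EuclideanSpace ℝ (Fin k)) (α : ℝ) :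
    Set (EuclideanSpace ℝ (Fin k)) :=
  {x | ∀ i, -α * ‖x‖ ≤ inner ℝ x (w i)}

/-- The `α`-enlargement `[bd K]^α = {x : |‖x‖₂ - xᵀ 1| ≤ α ‖x‖₂}`. -/
def bdEnlarged (k : ℕ) (α : ℝ) : Set (EuclideanSpace ℝ (Fin k)) :=
  {x | |‖x‖ - ∑ j, x j| ≤ α * ‖x‖}

/-- The points `x` with `‖x - t e_f‖₂ ≤ β t` for some vertex `e_f` and some `t ≥ 0`. -/
def nearAxes (k : ℕ) (β : ℝ) : Set (EuclideanSpace ℝ (Fin k)) :=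
  {x | ∃ f : Fin k, ∃ t : ℝ, 0 ≤ t ∧ ‖x - t • EuclideanSpace.single f (1 : ℝ)‖ ≤ β * t}

/-- The matrix with columns `w i` is `(α, β)`-sufficiently scattered. -/
structure IsSS {k s : ℕ} (w : Fin s → EuclideanSpace ℝ (Fin k)) (α β : ℝ) : Prop where
  alpha_nonneg : 0 ≤ α
  beta_nonneg : 0 ≤ β
  /-- Condition (S1). -/
  dualCone_subset : dualCone (cone w) ⊆ secondOrderCone k
  /-- Condition (S3). -/
  enlarged_subset : dualConeEnlarged w α ∩ bdEnlarged k α ⊆ nearAxes k β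

/-- `P` is an `(α, β)`-SS distribution on the simplex, witnessed by `s` distinct points of its
support and by the constants `r₀`, `c₀`. -/
structure IsSSDistribution {k : ℕ} (P : Measure (EuclideanSpace ℝ (Fin k))) (α β : ℝ)
    (s : ℕ) (r₀ c₀ : ℝ) : Prop where
  isProbabilityMeasure : IsProbabilityMeasure P
  on_simplex : P (simplex k)ᶜ = 0
  exists_points : ∃ w : Fin s → EuclideanSpace ℝ (Fin k), Function.Injective w ∧
    (∀ i, w i ∈ P.support) ∧ IsSS w α β ∧
    ∀ i, ∀ r : ℝ, 0 < r → r ≤ r₀ →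
      ENNReal.ofReal ((k - 1).factorial * c₀ * r ^ (k - 1)) ≤ P (Metric.closedBall (w i) r)

/-! Topic matrices. -/

/-- The columns of `C` are probability vectors. -/
def IsColumnStochastic {V k : ℕ} (C : Matrix (Fin V) (Fin k) ℝ) : Prop :=
  (∀ v f, 0 ≤ C v f) ∧ ∀ f, ∑ v, C v f = 1

/-- The spectral norm of a matrix. -/
def spectralNorm {V k : ℕ} (A : Matrix (Fin V) (Fin k) ℝ) : ℝ :=
  ‖(Matrix.toEuclideanLin A).toContinuousLinearMap‖

/-- `dis(C, C') = min_Π ‖C' - C Π‖₂`, the minimum being over the permutation matrices `Π`. -/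
def dis {V k : ℕ} (C C' : Matrix (Fin V) (Fin k) ℝ) : ℝ :=
  ⨅ π : Equiv.Perm (Fin k), spectralNorm (C' - C * π.permMatrix ℝ)

/-- (A1): the topic matrix has rank `k`, and its columns are bounded away from the boundary of
the simplex `Δ^{V-1}`. -/
structure AssumptionA1 {V k : ℕ} (C : Matrix (Fin V) (Fin k) ℝ) : Prop where
  columnStochastic : IsColumnStochastic C
  rank_eq : C.rank = k
  away_from_boundary : ∃ γ : ℝ, 0 < γ ∧ ∀ v f, γ ≤ C v f

/-- The centred weight matrix `W_c = W - (1/d) W 1 1ᵀ`. -/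
def centred {k d : ℕ} (W : Matrix (Fin k) (Fin d) ℝ) : Matrix (Fin k) (Fin d) ℝ :=
  W - (d : ℝ)⁻¹ • (W * Matrix.of fun (_ : Fin d) (_ : Fin d) => (1 : ℝ))

/-- (A2), with explicit constants `l` and `σ`. As the columns of `W` sum to one, `W_c W_cᵀ`
always has the eigenvector `1` with eigenvalue `0`; the first condition bounds the other `k - 1`
eigenvalues of `(1/d) W_c W_cᵀ`, those on the orthogonal complement of `1`, from below by `l`.
The second condition gives `k` affinely independent columns of `W` that form a `k × k` matrix
all of whose singular values are at least `σ`. -/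
structure AssumptionA2 {k d : ℕ} (W : Matrix (Fin k) (Fin d) ℝ) (l σ : ℝ) : Prop where
  eigenvalues_ge : ∀ x : Fin k → ℝ, ∑ j, x j = 0 →
    l * (x ⬝ᵥ x) ≤ x ⬝ᵥ (((d : ℝ)⁻¹ • (centred W * (centred W)ᵀ)) *ᵥ x)
  exists_columns : ∃ g : Fin k → Fin d,
    AffineIndependent ℝ (fun j => W.col (g j)) ∧
    ∀ x : EuclideanSpace ℝ (Fin k),
      σ * ‖x‖ ≤ ‖Matrix.toEuclideanLin (W.submatrix id g) x‖

/-! The model: documents, the integrated likelihood and its maximizers. -/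

/-- The likelihood `f_n(x | u)` of a document (a sequence of `n` words from a vocabulary of size
`V`) whose words are drawn independently with word probabilities `u`. -/
def likelihood {n V : ℕ} (x : Fin n → Fin V) (u : Fin V → ℝ) : ℝ :=
  ∏ j, u (x j)

/-- The uniform distribution on `Δ^{k-1}`: the normalized `(k-1)`-dimensional volume. -/
def uniformSimplex (k : ℕ) : Measure (EuclideanSpace ℝ (Fin k)) :=
  ProbabilityTheory.cond (Measure.hausdorffMeasure ((k : ℝ) - 1)) (simplex k)

/-- The integrated likelihood `F_{n×d}(C; X)`: the mixing weight of each document is integrated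
out with respect to the uniform distribution on the simplex. For affinely independent columns
the law of `C w` is uniform on `conv(C)`, so that the factors are
`|conv(C)|⁻¹ ∫_{conv(C)} f_n(x⁽ⁱ⁾ | u) du`; for affinely dependent columns, where `|conv(C)| = 0`,
this is the extension of that expression by continuity. -/
def integratedLikelihood {V k n d : ℕ} (C : Matrix (Fin V) (Fin k) ℝ)
    (X : Fin d → Fin n → Fin V) : ℝ :=
  ∏ i, ∫ w, likelihood (X i) (C *ᵥ w.ofLp) ∂(uniformSimplex k)

/-- `C` maximizes the integrated likelihood over all column-stochastic `V × k` matrices. -/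
def IsMLE {V k n d : ℕ} (X : Fin d → Fin n → Fin V) (C : Matrix (Fin V) (Fin k) ℝ) : Prop :=
  IsColumnStochastic C ∧ ∀ C' : Matrix (Fin V) (Fin k) ℝ, IsColumnStochastic C' →
    integratedLikelihood C' X ≤ integratedLikelihood C X

/-- The joint law of the mixing weight `w` and the word sequence `x` of one document: `w` has law
`P`, and given `w` the `n` words are independent with word probabilities `C w`. It gives the mass
`∫_A f_n(x | C w) dP(w)` to `A × {x}`. -/
def documentLaw {V k : ℕ} (C : Matrix (Fin V) (Fin k) ℝ)
    (P : Measure (EuclideanSpace ℝ (Fin k))) (n : ℕ) :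
    Measure (EuclideanSpace ℝ (Fin k) × (Fin n → Fin V)) :=
  ∑ x : Fin n → Fin V,
    (P.withDensity fun w => ENNReal.ofReal (likelihood x (C *ᵥ w.ofLp))).map fun w => (w, x)

/-- The joint law of the weights and the word sequences of `d` independent documents. -/
def sampleLaw {V k : ℕ} (C : Matrix (Fin V) (Fin k) ℝ)
    (P : Measure (EuclideanSpace ℝ (Fin k))) (n d : ℕ) :
    Measure (Fin d → EuclideanSpace ℝ (Fin k) × (Fin n → Fin V)) :=
  Measure.pi fun _ => documentLaw C P n

/-- The weight matrix `W⁰` of a sample: its `i`-th column is the weight of the `i`-th document. -/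
def weights {V k n d : ℕ} (z : Fin d → EuclideanSpace ℝ (Fin k) × (Fin n → Fin V)) :
    Matrix (Fin k) (Fin d) ℝ :=
  Matrix.of fun j i => (z i).1 j

/-- The observed data of a sample: its word sequences. -/
def words {V k n d : ℕ} (z : Fin d → EuclideanSpace ℝ (Fin k) × (Fin n → Fin V)) :
    Fin d → Fin n → Fin V :=
  fun i => (z i).2

/-- The noise level `√(log(n ∨ d) / n)`. -/
def noiseRate (n d : ℕ) : ℝ :=
  √(Real.log ((max n d : ℕ) : ℝ) / n)

/-- The sampling rate `(log d / d)^{1/(k-1)}`. -/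
def samplingRate (k d : ℕ) : ℝ :=
  (Real.log d / d) ^ (1 / ((k : ℝ) - 1))

end TopicModel

end

/-!
The maximizer `Ĉ` of the integrated likelihood is compared with two competitors.

Against `C₀` itself: averaging a document likelihood over the simplex loses at most a factor
polynomial in `n` with respect to its value at any point (`integral_likelihood_ge`, by shrinking
the simplex towards that point), whereas a probability vector at distance `t` from the word
frequencies loses a factor `exp (-c n t ^ 2)` (`likelihood_le`). Hence there are points `hᵢ` of
the simplex for which `Ĉ hᵢ` fits `C₀ wᵢ` in mean square up to the noise level `ν = √(log n / n)`
(`exists_fit`). The eigenvalue bound on the centred weights then yields, by least squares, a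
bounded matrix `N` with column sums one and `Ĉ N = C₀ + O(ν)` (`exists_transition_matrix`).

Against the enlargement, by a multiple of `ν`, of the simplex with vertex matrix `Ĉ N`: this
competitor lies in the same plane as `Ĉ`, is column-stochastic because `C₀` is bounded away from
the boundary, and carries nearly all of the mass of every document likelihood in that plane. The
ratio of the two integrated likelihoods is therefore at most the `d`-th power of a ratio of
volumes plus `1 / n`, and maximality gives `|det N| ≥ 1 - O(ν)` (`det_transition_ge`). The change
of variables rests on the scaling of the Hausdorff measure of the hyperplane `∑ j, x j = 1` under
matrices with column sums one (`hausdorffMeasure_image_mulVec`).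

The mean square fit also shows `N wᵢ ≥ -O(√d ν)` for every single document. The failure
probability contains the term `D₂ d / (n ∨ d) ^ c`, in which `c = 1 / 4`; this term is at least
one unless `d ^ 4 < n`, and in that regime `√d ν ≤ 2 / d` is at most of the order of the sampling
rate `(log d / d) ^ (1 / (k - 1))`.

On the event that each scattered point has a sampled weight within a multiple of the sampling rate
(`sampleLaw_real_ge`), the rows `x` of `N` consequently satisfy `xᵀ w ≥ -O(ρ)` at the scattered
points `w`, where `ρ` is the sum of the two rates. By condition (S1) their norms exceed their
coordinate sums by at most `O(ρ)`, and since these sums add up to `k` while the product of the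
norms is at least `|det N| ≥ 1 - O(ρ)` by Hadamard's inequality, each norm equals its coordinate
sum up to `O(ρ)` (`norm_ge_of_det_ge`). As `ρ` is small compared with `α`, condition (S3) applies
to the rows and puts them near the axes, and the column sums make `N` a permutation matrix up to
`O(β)` (`exists_perm_near`). So `C₀ = Ĉ N + O(ν)` is `Ĉ` with permuted columns, up to
`O(ν) + O(β)`; the sampling rate enters only through the requirement on `α`.
-/

noncomputable section

namespace TopicModel

/-! ### The uniform distribution on the simplex under linear maps -/

/-- The linear functional `x ↦ ∑ j, x j` on `ℝ^k`. -/
def coordSum (k : ℕ) : EuclideanSpace ℝ (Fin k) →ₗ[ℝ] ℝ where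
  toFun x := ∑ j, x j
  map_add' x y := by simp [Finset.sum_add_distrib]
  map_smul' c x := by simp [Finset.mul_sum]

@[simp] lemma coordSum_apply {k : ℕ} (x : EuclideanSpace ℝ (Fin k)) :
    coordSum k x = ∑ j, x j := rfl

/-- A matrix whose columns sum to one preserves coordinate sums. -/
lemma sum_mulVec_of_colSum {m k : ℕ} {T : Matrix (Fin m) (Fin k) ℝ}
    (hT : ∀ f, ∑ j, T j f = 1) (x : Fin k → ℝ) : ∑ j, (T *ᵥ x) j = ∑ f, x f := by
  simp only [Matrix.mulVec, dotProduct]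
  rw [Finset.sum_comm]
  simp [← Finset.sum_mul, hT]

lemma finrank_ker_coordSum {k : ℕ} (hk : 1 ≤ k) :
    Module.finrank ℝ (LinearMap.ker (coordSum k)) = k - 1 := by
  have h := LinearMap.finrank_range_add_finrank_ker (coordSum k)
  have hs : LinearMap.range (coordSum k) = ⊤ := by
    rw [LinearMap.range_eq_top]
    intro c
    refine ⟨c • EuclideanSpace.single ⟨0, hk⟩ 1, ?_⟩
    rw [map_smul]; simp
  rw [hs] at h
  simp at h
  omega

/-- A linear map that preserves coordinate sums acts as the identity on the quotient by the
hyperplane `∑ j, x j = 0`, so its restriction to that hyperplane has the same determinant. -/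
lemma det_restrict_ker_coordSum {k : ℕ}
    (T : EuclideanSpace ℝ (Fin k) →ₗ[ℝ] EuclideanSpace ℝ (Fin k))
    (hT : ∀ x, coordSum k (T x) = coordSum k x)
    (h : LinearMap.ker (coordSum k) ≤ (LinearMap.ker (coordSum k)).comap T) :
    (T.restrict h).det = T.det := by
  rw [LinearMap.det_eq_det_mul_det (LinearMap.ker (coordSum k)) T h]
  have : (LinearMap.ker (coordSum k)).mapQ (LinearMap.ker (coordSum k)) T h = LinearMap.id := by
    apply Submodule.linearMap_qext
    ext x
    simp only [LinearMap.comp_apply, Submodule.mkQ_apply, Submodule.mapQ_apply, LinearMap.id_apply]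
    rw [Submodule.Quotient.eq, LinearMap.mem_ker, map_sub, hT, sub_self]
  rw [this, LinearMap.det_id, mul_one]

/-- The `(k-1)`-dimensional Hausdorff measure of a translate of a subset of the hyperplane
`∑ j, x j = 0`. -/
lemma hausdorffMeasure_translate {k : ℕ} (p : EuclideanSpace ℝ (Fin k)) (hk : 1 ≤ k)
    (S : Set (LinearMap.ker (coordSum k))) :
    Measure.hausdorffMeasure ((k : ℝ) - 1)
        ((fun y : LinearMap.ker (coordSum k) => p + (y : EuclideanSpace ℝ (Fin k))) '' S) =
      Measure.hausdorffMeasure (Module.finrank ℝ (LinearMap.ker (coordSum k)) : ℝ) S := by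
  have hk' : ((k : ℝ) - 1) = (Module.finrank ℝ (LinearMap.ker (coordSum k)) : ℝ) := by
    rw [finrank_ker_coordSum hk, Nat.cast_sub hk]; simp
  rw [hk']
  apply Isometry.hausdorffMeasure_image
  · intro x y
    simp [edist_dist, dist_eq_norm]
  · left; positivity

/-- Change of variables in the hyperplane `∑ j, x j = 1`. -/
lemma hausdorffMeasure_image_mulVec {k : ℕ} (hk : 1 ≤ k) {T : Matrix (Fin k) (Fin k) ℝ}
    (hT : ∀ f, ∑ j, T j f = 1) {S : Set (EuclideanSpace ℝ (Fin k))} (hS : ∀ x ∈ S, ∑ j, x j = 1) :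
    Measure.hausdorffMeasure ((k : ℝ) - 1) (Matrix.toEuclideanLin T '' S) =
      ENNReal.ofReal |T.det| * Measure.hausdorffMeasure ((k : ℝ) - 1) S := by
  have hsum : ∀ x, coordSum k (Matrix.toEuclideanLin T x) = coordSum k x := fun x => by
    simpa using sum_mulVec_of_colSum hT x.ofLp
  have hker : LinearMap.ker (coordSum k) ≤ (LinearMap.ker (coordSum k)).comap
      (Matrix.toEuclideanLin T) := by
    intro x hx
    rw [Submodule.mem_comap, LinearMap.mem_ker, hsum, hx]
  set p : EuclideanSpace ℝ (Fin k) := EuclideanSpace.single ⟨0, hk⟩ 1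
  have hp : coordSum k p = 1 := by simp [p]
  set S₀ : Set (LinearMap.ker (coordSum k)) := {y | p + (y : EuclideanSpace ℝ (Fin k)) ∈ S}
  have hS0 : S =
      (fun y : LinearMap.ker (coordSum k) => p + (y : EuclideanSpace ℝ (Fin k))) '' S₀ := by
    ext x
    constructor
    · intro hx
      refine ⟨⟨x - p, ?_⟩, ?_, ?_⟩
      · rw [LinearMap.mem_ker, map_sub, hp, coordSum_apply, hS x hx, sub_self]
      · simpa [S₀] using hx
      · simp
    · rintro ⟨y, hy, rfl⟩
      exact hy
  have hTS : Matrix.toEuclideanLin T '' S =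
      (fun y : LinearMap.ker (coordSum k) =>
        Matrix.toEuclideanLin T p + (y : EuclideanSpace ℝ (Fin k))) ''
        (((Matrix.toEuclideanLin T).restrict hker) '' S₀) := by
    rw [hS0, Set.image_image, Set.image_image]
    apply Set.image_congr
    intro y _
    simp [map_add, LinearMap.restrict_apply]
  rw [hTS, hausdorffMeasure_translate _ hk, Measure.addHaar_image_linearMap,
    det_restrict_ker_coordSum _ hsum, ← hausdorffMeasure_translate p hk S₀, ← hS0]
  congr 3
  exact LinearMap.det_toLpLin 2 T

lemma isCompact_simplex (k : ℕ) : IsCompact (simplex k) := by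
  have : simplex k = (WithLp.toLp 2) '' (stdSimplex ℝ (Fin k)) := by
    ext x
    simp only [simplex, Set.mem_ofPred_eq, stdSimplex, Set.mem_image]
    constructor
    · intro h; exact ⟨x.ofLp, h, rfl⟩
    · rintro ⟨y, hy, rfl⟩; exact hy
  rw [this]
  exact (isCompact_stdSimplex ℝ (Fin k)).image (PiLp.continuous_toLp 2 _)

lemma measurableSet_simplex (k : ℕ) : MeasurableSet (simplex k) :=
  (isCompact_simplex k).isClosed.measurableSet

/-- The simplex, seen from its barycentre inside the hyperplane `∑ j, x j = 0`. -/
lemma simplex_eq_image {k : ℕ} (hk : 1 ≤ k) :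
    simplex k = (fun y : LinearMap.ker (coordSum k) =>
      (WithLp.toLp 2 fun _ => (1 / k : ℝ)) + (y : EuclideanSpace ℝ (Fin k))) ''
      {y | ∀ j, -(1 / k : ℝ) ≤ (y : EuclideanSpace ℝ (Fin k)) j} := by
  have hk0 : (k : ℝ) ≠ 0 := by positivity
  ext x
  constructor
  · rintro ⟨h0, h1⟩
    refine ⟨⟨x - (WithLp.toLp 2 fun _ => (1 / k : ℝ)), ?_⟩, ?_, ?_⟩
    · rw [LinearMap.mem_ker, map_sub]
      simp [h1, hk0]
    · intro j
      have := h0 j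
      simp only [PiLp.sub_apply]
      linarith
    · simp
  · rintro ⟨y, hy, rfl⟩
    refine ⟨fun j => ?_, ?_⟩
    · have := hy j
      simp only [PiLp.add_apply]
      linarith
    · have : ∑ j, (y : EuclideanSpace ℝ (Fin k)) j = 0 := y.2
      simp [Finset.sum_add_distrib, this, hk0]

lemma hausdorffMeasure_simplex_ne_zero {k : ℕ} (hk : 1 ≤ k) :
    Measure.hausdorffMeasure ((k : ℝ) - 1) (simplex k) ≠ 0 := by
  rw [simplex_eq_image hk, hausdorffMeasure_translate _ hk]
  apply (Measure.measure_pos_of_mem_nhds _ (x := 0) _).ne'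
  refine Filter.eventually_all.2 fun j => ?_
  have hc : Continuous fun y : LinearMap.ker (coordSum k) => (y : EuclideanSpace ℝ (Fin k)) j := by
    fun_prop
  have hneg : -(1 / k : ℝ) < ((0 : LinearMap.ker (coordSum k)) : EuclideanSpace ℝ (Fin k)) j := by
    have : (0 : ℝ) < 1 / k := by positivity
    simpa using this
  exact (hc.continuousAt.eventually (lt_mem_nhds hneg)).mono fun _ h => le_of_lt h

lemma hausdorffMeasure_simplex_ne_top {k : ℕ} (hk : 1 ≤ k) :
    Measure.hausdorffMeasure ((k : ℝ) - 1) (simplex k) ≠ ⊤ := by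
  rw [simplex_eq_image hk, hausdorffMeasure_translate _ hk]
  apply (IsCompact.measure_lt_top _).ne
  set g := (fun y : LinearMap.ker (coordSum k) =>
      (WithLp.toLp 2 fun _ => (1 / k : ℝ)) + (y : EuclideanSpace ℝ (Fin k))) with hg
  have hcl : Topology.IsClosedEmbedding g :=
    (Homeomorph.addLeft _).isClosedEmbedding.comp
      (LinearMap.ker (coordSum k)).closed_of_finiteDimensional.isClosedEmbedding_subtypeVal
  rw [hcl.isCompact_iff, ← simplex_eq_image hk]
  exact isCompact_simplex k

lemma isProbabilityMeasure_uniformSimplex {k : ℕ} (hk : 1 ≤ k) :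
    IsProbabilityMeasure (uniformSimplex k) :=
  ProbabilityTheory.cond_isProbabilityMeasure_of_finite (hausdorffMeasure_simplex_ne_zero hk)
    (hausdorffMeasure_simplex_ne_top hk)

lemma uniformSimplex_compl (k : ℕ) : uniformSimplex k (simplex k)ᶜ = 0 := by
  rw [uniformSimplex, ProbabilityTheory.cond_apply (measurableSet_simplex k)]
  simp

lemma ae_mem_simplex (k : ℕ) : ∀ᵐ w ∂uniformSimplex k, w ∈ simplex k :=
  uniformSimplex_compl k

lemma continuous_toEuclideanLin {m k : ℕ} (T : Matrix (Fin m) (Fin k) ℝ) :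
    Continuous (Matrix.toEuclideanLin T) := LinearMap.continuous_of_finiteDimensional _

/-- The part of a set inside the image `T(Δ)` of the simplex has Hausdorff measure `|det T|` times
that of its pullback to the simplex. -/
lemma hausdorffMeasure_inter_image {k : ℕ} (hk : 1 ≤ k) {T : Matrix (Fin k) (Fin k) ℝ}
    (hT : ∀ f, ∑ j, T j f = 1) (A : Set (EuclideanSpace ℝ (Fin k))) :
    Measure.hausdorffMeasure ((k : ℝ) - 1) (A ∩ Matrix.toEuclideanLin T '' simplex k) =
      ENNReal.ofReal |T.det| * Measure.hausdorffMeasure ((k : ℝ) - 1)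
        (simplex k ∩ Matrix.toEuclideanLin T ⁻¹' A) := by
  rw [← hausdorffMeasure_image_mulVec hk hT (fun x hx => hx.1.2), Set.image_inter_preimage,
    Set.inter_comm]

lemma measurableSet_image_simplex {k : ℕ} (T : Matrix (Fin k) (Fin k) ℝ) :
    MeasurableSet (Matrix.toEuclideanLin T '' simplex k) :=
  ((isCompact_simplex k).image (continuous_toEuclideanLin T)).isClosed.measurableSet

/-- Inside `T(Δ)`, the uniform distribution on the simplex is at most `|det T|` times the image of
the uniform distribution under `T`. -/
lemma restrict_uniformSimplex_le {k : ℕ} (hk : 1 ≤ k) {T : Matrix (Fin k) (Fin k) ℝ}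
    (hT : ∀ f, ∑ j, T j f = 1) :
    (uniformSimplex k).restrict (Matrix.toEuclideanLin T '' simplex k) ≤
      ENNReal.ofReal |T.det| • (uniformSimplex k).map (Matrix.toEuclideanLin T) := by
  refine Measure.le_iff.2 fun A hA => ?_
  rw [Measure.restrict_apply hA, Measure.smul_apply,
    Measure.map_apply (continuous_toEuclideanLin T).measurable hA, uniformSimplex,
    ProbabilityTheory.cond_apply (measurableSet_simplex k),
    ProbabilityTheory.cond_apply (measurableSet_simplex k), smul_eq_mul, mul_left_comm,
    ← hausdorffMeasure_inter_image hk hT]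
  exact mul_le_mul_right (measure_mono Set.inter_subset_right) _

lemma map_uniformSimplex_le {k : ℕ} (hk : 1 ≤ k) {T : Matrix (Fin k) (Fin k) ℝ}
    (hT : ∀ f, ∑ j, T j f = 1) (hTΔ : Matrix.toEuclideanLin T '' simplex k ⊆ simplex k) :
    ENNReal.ofReal |T.det| • (uniformSimplex k).map (Matrix.toEuclideanLin T) ≤
      uniformSimplex k := by
  refine Measure.le_iff.2 fun A hA => ?_
  rw [Measure.smul_apply,
    Measure.map_apply (continuous_toEuclideanLin T).measurable hA, uniformSimplex,
    ProbabilityTheory.cond_apply (measurableSet_simplex k),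
    ProbabilityTheory.cond_apply (measurableSet_simplex k), smul_eq_mul, mul_left_comm,
    ← hausdorffMeasure_inter_image hk hT, Set.inter_comm (simplex k)]
  gcongr

/-- The homothety with centre `w` (a point with coordinate sum one) and ratio `a`, as a linear map
that preserves the hyperplane `∑ j, x j = 1`. -/
def homothety {k : ℕ} (w : Fin k → ℝ) (a : ℝ) : Matrix (Fin k) (Fin k) ℝ :=
  a • (1 : Matrix (Fin k) (Fin k) ℝ) + (1 - a) • Matrix.of fun i _ => w i

lemma homothety_mulVec {k : ℕ} (w : Fin k → ℝ) (a : ℝ) (v : Fin k → ℝ) (hv : ∑ j, v j = 1)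
    (j : Fin k) : (homothety w a *ᵥ v) j = a * v j + (1 - a) * w j := by
  have : (Matrix.of (fun i _ => w i) *ᵥ v) j = w j := by
    simp [Matrix.mulVec, dotProduct, ← Finset.mul_sum, hv]
  simp only [homothety, Matrix.add_mulVec, Matrix.smul_mulVec, Pi.add_apply, Pi.smul_apply,
    Matrix.one_mulVec, smul_eq_mul, this]

lemma homothety_colSum {k : ℕ} {w : Fin k → ℝ} (hw : ∑ j, w j = 1) (a : ℝ) (f : Fin k) :
    ∑ j, homothety w a j f = 1 := by
  simp [homothety, Finset.sum_add_distrib, ← Finset.mul_sum, hw, Matrix.one_apply]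

lemma det_homothety {k : ℕ} (hk : 1 ≤ k) {w : Fin k → ℝ} (hw : ∑ j, w j = 1) {a : ℝ} (ha : a ≠ 0) :
    (homothety w a).det = a ^ (k - 1) := by
  have h : homothety w a = a • (1 + Matrix.replicateCol Unit (((1 - a) / a) • w) *
      Matrix.replicateRow Unit (1 : Fin k → ℝ)) := by
    ext i j
    simp [homothety, Matrix.mul_apply]
    field_simp
  rw [h, Matrix.det_smul, Matrix.det_one_add_replicateCol_mul_replicateRow, Fintype.card_fin]
  have : (1 : Fin k → ℝ) ⬝ᵥ (((1 - a) / a) • w) = (1 - a) / a := by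
    simp [dotProduct, ← Finset.mul_sum, hw]
  rw [this]
  obtain ⟨m, rfl⟩ := Nat.exists_eq_add_of_le' hk
  simp only [Nat.add_sub_cancel, pow_succ]
  field_simp
  ring

/-! ### Likelihoods and their averages over the simplex -/

/-- The relative frequency of the word `v` in the document `x`. -/
def wordFreq {n V : ℕ} (x : Fin n → Fin V) (v : Fin V) : ℝ :=
  (∑ j, if x j = v then (1 : ℝ) else 0) / n

lemma sum_comp_eq_wordFreq {n V : ℕ} (hn : 1 ≤ n) (x : Fin n → Fin V) (g : Fin V → ℝ) :
    ∑ j, g (x j) = n * ∑ a, wordFreq x a * g a := by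
  have hn' : (n : ℝ) ≠ 0 := by positivity
  simp only [wordFreq, div_mul_eq_mul_div, ← Finset.sum_div]
  rw [mul_div_cancel₀ _ hn']
  simp only [Finset.sum_mul]
  rw [Finset.sum_comm]
  simp

lemma likelihood_nonneg {n V : ℕ} (x : Fin n → Fin V) {u : Fin V → ℝ} (hu : ∀ a, 0 ≤ u a) :
    0 ≤ likelihood x u := Finset.prod_nonneg fun _ _ => hu _

lemma likelihood_pos {n V : ℕ} (x : Fin n → Fin V) {u : Fin V → ℝ} (hu : ∀ a, 0 < u a) :
    0 < likelihood x u := Finset.prod_pos fun _ _ => hu _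

/-- Quantitative Gibbs inequality: if the word frequencies of `x` are close to `q`, then a
probability vector `p` far from `q` has a much smaller likelihood than `q`. -/
lemma likelihood_le {n V : ℕ} (hn : 1 ≤ n) (x : Fin n → Fin V) {p q : Fin V → ℝ} {γ : ℝ}
    (hγ : 0 < γ) (hp : ∀ a, 0 ≤ p a) (hp1 : ∑ a, p a = 1) (hq : ∀ a, γ ≤ q a)
    (hq1 : ∑ a, q a = 1) :
    likelihood x p ≤ likelihood x q *
      Real.exp (n * (2 / γ * ∑ a, (wordFreq x a - q a) ^ 2 - (∑ a, (p a - q a) ^ 2) / 8)) := by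
  have hq0 : ∀ a, 0 < q a := fun a => hγ.trans_le (hq a)
  set s : Fin V → ℝ := fun a => √(p a / q a)
  have hs : ∀ a, p a = q a * s a ^ 2 := fun a => by
    rw [Real.sq_sqrt (div_nonneg (hp a) (hq0 a).le), mul_div_cancel₀ _ (hq0 a).ne']
  have hs0 : ∀ a, 0 ≤ s a := fun a => Real.sqrt_nonneg _
  have hpt : ∀ a, p a ≤ q a * Real.exp (2 * (s a - 1)) := fun a => by
    rw [hs a]
    have h1 : s a ≤ Real.exp (s a - 1) := by linarith [Real.add_one_le_exp (s a - 1)]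
    have h2 : Real.exp (2 * (s a - 1)) = Real.exp (s a - 1) ^ 2 := by
      rw [← Real.exp_nat_mul]; norm_num
    rw [h2]
    exact mul_le_mul_of_nonneg_left (pow_le_pow_left₀ (hs0 a) h1 2) (hq0 a).le
  have hterm : ∀ a, wordFreq x a * (2 * (s a - 1)) ≤
      2 / γ * (wordFreq x a - q a) ^ 2 - (p a - q a) ^ 2 / 8 + (p a - q a) := fun a => by
    have hp1a : p a ≤ 1 := hp1 ▸ Finset.single_le_sum (fun b _ => hp b) (Finset.mem_univ a)
    have hq1a : q a ≤ 1 := hq1 ▸ Finset.single_le_sum (fun b _ => (hq0 b).le) (Finset.mem_univ a)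
    -- the arithmetic-geometric mean inequality, with the weights `q a`
    have h1 : 2 * (wordFreq x a - q a) * (s a - 1) ≤
        2 / q a * (wordFreq x a - q a) ^ 2 + q a * (s a - 1) ^ 2 / 2 := by
      have h := sq_nonneg (2 * (wordFreq x a - q a) - q a * (s a - 1))
      have hqa := hq0 a
      rw [div_mul_eq_mul_div, div_add' _ _ _ hqa.ne', le_div_iff₀ hqa]
      nlinarith
    have h2 : 2 / q a * (wordFreq x a - q a) ^ 2 ≤ 2 / γ * (wordFreq x a - q a) ^ 2 := by
      gcongr
      exact hq a
    have h3 : (p a - q a) ^ 2 ≤ 4 * (q a * (s a - 1) ^ 2) := by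
      have h4 : (p a - q a) ^ 2 = (q a * (s a - 1) ^ 2) * (q a * (s a + 1) ^ 2) := by
        rw [hs a]; ring
      rw [h4, mul_comm]
      refine mul_le_mul_of_nonneg_right ?_ (mul_nonneg (hq0 a).le (sq_nonneg _))
      have := hs a
      nlinarith [mul_nonneg (hq0 a).le (sq_nonneg (s a - 1))]
    have h5 := hs a
    nlinarith
  calc likelihood x p ≤ ∏ j, (q (x j) * Real.exp (2 * (s (x j) - 1))) :=
        Finset.prod_le_prod (fun j _ => hp _) fun j _ => hpt _
    _ = likelihood x q * Real.exp (n * ∑ a, wordFreq x a * (2 * (s a - 1))) := by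
        rw [Finset.prod_mul_distrib, ← Real.exp_sum,
          sum_comp_eq_wordFreq hn x fun a => 2 * (s a - 1)]
        rfl
    _ ≤ _ := by
        have : ∑ a, wordFreq x a * (2 * (s a - 1)) ≤
            2 / γ * ∑ a, (wordFreq x a - q a) ^ 2 - (∑ a, (p a - q a) ^ 2) / 8 := by
          refine (Finset.sum_le_sum fun a _ => hterm a).trans_eq ?_
          rw [Finset.sum_add_distrib, Finset.sum_sub_distrib, Finset.sum_sub_distrib, hp1, hq1,
            Finset.mul_sum, Finset.sum_div]
          ring
        have := likelihood_nonneg x fun a => (hq0 a).le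
        gcongr

lemma mulVec_nonneg {m k : ℕ} {C : Matrix (Fin m) (Fin k) ℝ} (hC : ∀ v f, 0 ≤ C v f)
    {w : Fin k → ℝ} (hw : ∀ j, 0 ≤ w j) (v : Fin m) : 0 ≤ (C *ᵥ w) v := by
  rw [Matrix.mulVec_eq_sum, Finset.sum_apply]
  exact Finset.sum_nonneg fun j _ => by simpa using mul_nonneg (hC v j) (hw j)

lemma continuous_likelihood_mulVec {V k n : ℕ} (x : Fin n → Fin V) (C : Matrix (Fin V) (Fin k) ℝ) :
    Continuous fun w : EuclideanSpace ℝ (Fin k) => likelihood x (C *ᵥ w.ofLp) := by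
  unfold likelihood Matrix.mulVec dotProduct
  fun_prop

lemma integrable_likelihood {V k n : ℕ} (hk : 1 ≤ k) (x : Fin n → Fin V)
    (C : Matrix (Fin V) (Fin k) ℝ) :
    Integrable (fun w : EuclideanSpace ℝ (Fin k) => likelihood x (C *ᵥ w.ofLp))
      (uniformSimplex k) := by
  have := isProbabilityMeasure_uniformSimplex hk
  have h := (continuous_likelihood_mulVec x C).continuousOn.integrableOn_compact
    (μ := uniformSimplex k) (isCompact_simplex k)
  rwa [IntegrableOn, Measure.restrict_eq_self_of_ae_mem (ae_mem_simplex k)] at h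

lemma integral_likelihood_nonneg {V k n : ℕ} (x : Fin n → Fin V)
    {C : Matrix (Fin V) (Fin k) ℝ} (hC : IsColumnStochastic C) :
    0 ≤ ∫ w, likelihood x (C *ᵥ w.ofLp) ∂(uniformSimplex k) :=
  integral_nonneg_of_ae <| (ae_mem_simplex k).mono fun _ hw =>
    likelihood_nonneg x (mulVec_nonneg hC.1 hw.1)

lemma toEuclideanLin_ofLp {m k : ℕ} (T : Matrix (Fin m) (Fin k) ℝ)
    (v : EuclideanSpace ℝ (Fin k)) : (Matrix.toEuclideanLin T v).ofLp = T *ᵥ v.ofLp := rfl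

lemma integrable_map {V k n : ℕ} (hk : 1 ≤ k) (x : Fin n → Fin V)
    (C : Matrix (Fin V) (Fin k) ℝ) (T : Matrix (Fin k) (Fin k) ℝ) :
    Integrable (fun w : EuclideanSpace ℝ (Fin k) => likelihood x (C *ᵥ w.ofLp))
      ((uniformSimplex k).map (Matrix.toEuclideanLin T)) := by
  rw [integrable_map_measure (continuous_likelihood_mulVec x C).aestronglyMeasurable
    (continuous_toEuclideanLin T).aemeasurable]
  have : ((fun w : EuclideanSpace ℝ (Fin k) => likelihood x (C *ᵥ w.ofLp)) ∘
      Matrix.toEuclideanLin T) = fun w => likelihood x ((C * T) *ᵥ w.ofLp) := by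
    ext w
    simp [Matrix.mulVec_mulVec]
  rw [this]
  exact integrable_likelihood hk x _

lemma integral_smul_map {V k n : ℕ} (x : Fin n → Fin V)
    (C : Matrix (Fin V) (Fin k) ℝ) (T : Matrix (Fin k) (Fin k) ℝ) :
    ∫ w, likelihood x (C *ᵥ w.ofLp)
      ∂(ENNReal.ofReal |T.det| • (uniformSimplex k).map (Matrix.toEuclideanLin T)) =
    |T.det| * ∫ w, likelihood x ((C * T) *ᵥ w.ofLp) ∂(uniformSimplex k) := by
  rw [integral_smul_measure, ENNReal.toReal_ofReal (abs_nonneg _), smul_eq_mul,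
    integral_map (continuous_toEuclideanLin T).aemeasurable
      (continuous_likelihood_mulVec x C).aestronglyMeasurable]
  simp [Matrix.mulVec_mulVec]

/-- The average likelihood is at least a polynomial fraction of the likelihood at any point: shrink
the simplex towards that point with ratio `1 / (2 n)`. -/
lemma integral_likelihood_ge {V k n : ℕ} (hk : 1 ≤ k) (hn : 2 ≤ n) (x : Fin n → Fin V)
    {C : Matrix (Fin V) (Fin k) ℝ} (hC : IsColumnStochastic C) {y : EuclideanSpace ℝ (Fin k)}
    (hy : y ∈ simplex k) :
    Real.exp (-(2 * k * Real.log n)) * likelihood x (C *ᵥ y.ofLp) ≤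
      ∫ w, likelihood x (C *ᵥ w.ofLp) ∂(uniformSimplex k) := by
  have := isProbabilityMeasure_uniformSimplex hk
  have hn2 : (2 : ℝ) ≤ n := by exact_mod_cast hn
  have hn0 : (0 : ℝ) < n := by linarith
  set a : ℝ := 1 / (2 * n) with ha
  have ha0 : 0 < a := by positivity
  have ha1 : a ≤ 1 := by rw [ha, div_le_one (by positivity)]; linarith
  set T := homothety y.ofLp a
  have hTs : ∀ f, ∑ j, T j f = 1 := homothety_colSum hy.2 a
  have hdet : T.det = a ^ (k - 1) := det_homothety hk hy.2 ha0.ne'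
  have hTΔ : Matrix.toEuclideanLin T '' simplex k ⊆ simplex k := by
    rintro _ ⟨v, hv, rfl⟩
    refine ⟨fun j => ?_, ?_⟩
    · rw [toEuclideanLin_ofLp, homothety_mulVec _ _ _ hv.2]
      have := hv.1 j; have := hy.1 j
      have : 0 ≤ 1 - a := by linarith
      positivity
    · rw [toEuclideanLin_ofLp, sum_mulVec_of_colSum hTs, hv.2]
  have h1 := integral_mono_measure (map_uniformSimplex_le hk hTs hTΔ)
    ((ae_mem_simplex k).mono fun w hw =>
      likelihood_nonneg x (mulVec_nonneg hC.1 hw.1)) (integrable_likelihood hk x C)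
  rw [integral_smul_map] at h1
  refine le_trans ?_ h1
  have hCy := likelihood_nonneg x (mulVec_nonneg hC.1 hy.1)
  have h2 : (1 / 2) * likelihood x (C *ᵥ y.ofLp) ≤
      ∫ w, likelihood x ((C * T) *ᵥ w.ofLp) ∂(uniformSimplex k) := by
    have h3 : ∀ᵐ w ∂uniformSimplex k, (1 / 2) * likelihood x (C *ᵥ y.ofLp) ≤
        likelihood x ((C * T) *ᵥ w.ofLp) := by
      filter_upwards [ae_mem_simplex k] with w hw
      have hT : T *ᵥ w.ofLp = a • w.ofLp + (1 - a) • y.ofLp := by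
        ext j
        simpa using homothety_mulVec _ _ _ hw.2 j
      rw [← Matrix.mulVec_mulVec, hT]
      have hber : (1 / 2 : ℝ) ≤ (1 - a) ^ n := by
        have := one_add_mul_le_pow (a := -a) (by linarith) n
        have h4 : (n : ℝ) * a = 1 / 2 := by rw [ha]; field_simp
        have h5 : 1 + (n : ℝ) * -a = 1 / 2 := by rw [mul_neg, h4]; norm_num
        rw [h5] at this
        simpa [sub_eq_add_neg] using this
      calc (1 / 2) * likelihood x (C *ᵥ y.ofLp) ≤ (1 - a) ^ n * likelihood x (C *ᵥ y.ofLp) := by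
            gcongr
        _ = ∏ j : Fin n, ((1 - a) * (C *ᵥ y.ofLp) (x j)) := by
            rw [Finset.prod_mul_distrib]; simp [likelihood]
        _ ≤ _ := by
            refine Finset.prod_le_prod (fun j _ => mul_nonneg (by linarith)
              (mulVec_nonneg hC.1 hy.1 _)) fun j _ => ?_
            have := mulVec_nonneg hC.1 hw.1 (x j)
            simp only [Matrix.mulVec_add, Matrix.mulVec_smul, Pi.add_apply, Pi.smul_apply,
              smul_eq_mul]
            have := mul_nonneg ha0.le this
            linarith
    have := integral_mono_ae (integrable_const _) (integrable_likelihood hk x (C * T)) h3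
    simpa using this
  have h6 : Real.exp (-(2 * k * Real.log n)) ≤ |T.det| * (1 / 2) := by
    rw [hdet, abs_of_nonneg (by positivity)]
    have h7 : Real.exp (-(2 * k * Real.log n)) = ((n : ℝ) ^ (2 * k))⁻¹ := by
      rw [Real.exp_neg, ← Nat.cast_ofNat, ← Nat.cast_mul, ← Real.log_pow,
        Real.exp_log (by positivity)]
    rw [h7]
    calc ((n : ℝ) ^ (2 * k))⁻¹ ≤ a ^ k := by
          rw [ha, one_div, inv_pow, pow_mul]
          gcongr
          nlinarith
      _ = a ^ (k - 1) * a := by rw [← pow_succ, Nat.sub_add_cancel hk]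
      _ ≤ a ^ (k - 1) * (1 / 2) := by
          gcongr
          rw [ha]
          gcongr
          linarith
  calc _ ≤ (|T.det| * (1 / 2)) * likelihood x (C *ᵥ y.ofLp) := by gcongr
    _ = |T.det| * ((1 / 2) * likelihood x (C *ᵥ y.ofLp)) := by ring
    _ ≤ _ := by gcongr

/-- Comparison of the average likelihoods of `C` and `C T`: apart from the part of the simplex that
`T(Δ)` misses, they differ by at most the factor `|det T|`. -/
lemma integral_likelihood_le {V k n : ℕ} (hk : 1 ≤ k) (x : Fin n → Fin V)
    {C : Matrix (Fin V) (Fin k) ℝ} {T : Matrix (Fin k) (Fin k) ℝ}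
    (hT : ∀ f, ∑ j, T j f = 1) (hCT : IsColumnStochastic (C * T)) {B : ℝ} (hB0 : 0 ≤ B)
    (hB : ∀ w ∈ simplex k, w ∉ Matrix.toEuclideanLin T '' simplex k →
      likelihood x (C *ᵥ w.ofLp) ≤ B) :
    ∫ w, likelihood x (C *ᵥ w.ofLp) ∂(uniformSimplex k) ≤
      |T.det| * (∫ w, likelihood x ((C * T) *ᵥ w.ofLp) ∂(uniformSimplex k)) + B := by
  have := isProbabilityMeasure_uniformSimplex hk
  have hI := integrable_likelihood hk x C
  rw [← integral_add_compl (measurableSet_image_simplex T) hI]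
  refine add_le_add ?_ ?_
  · rw [← integral_smul_map]
    refine integral_mono_measure (restrict_uniformSimplex_le hk hT) ?_ ?_
    · refine Measure.ae_smul_measure ?_ _
      refine (ae_map_iff (continuous_toEuclideanLin T).aemeasurable (measurableSet_le
        measurable_const (continuous_likelihood_mulVec x C).measurable)).2 ?_
      filter_upwards [ae_mem_simplex k] with v hv
      rw [toEuclideanLin_ofLp, Matrix.mulVec_mulVec]
      exact likelihood_nonneg x (mulVec_nonneg hCT.1 hv.1)
    · exact (integrable_map hk x C T).smul_measure ENNReal.ofReal_ne_top
  · have h1 : ∫ w in (Matrix.toEuclideanLin T '' simplex k)ᶜ, likelihood x (C *ᵥ w.ofLp)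
        ∂(uniformSimplex k) ≤
        ∫ _w in (Matrix.toEuclideanLin T '' simplex k)ᶜ, B ∂(uniformSimplex k) := by
      refine integral_mono_ae hI.integrableOn (integrable_const _) ?_
      filter_upwards [ae_restrict_of_ae (ae_mem_simplex k),
        ae_restrict_mem (measurableSet_image_simplex T).compl] with w hw hw'
      exact hB w hw hw'
    refine h1.trans ?_
    rw [setIntegral_const, smul_eq_mul]
    exact mul_le_of_le_one_left hB0 measureReal_le_one

/-! ### Recovering the plane of topics from the fitted documents -/

lemma sum_sq_add_const {ι : Type*} [Fintype ι] (z : ι → ℝ) (m t : ℝ)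
    (hm : ∑ i, z i = Fintype.card ι * m) :
    ∑ i, (z i + t) ^ 2 = ∑ i, (z i - m) ^ 2 + Fintype.card ι * (m + t) ^ 2 := by
  have h : ∀ i, (z i + t) ^ 2 = (z i - m) ^ 2 + (2 * (m + t) * z i + (t ^ 2 - m ^ 2)) := fun i => by
    ring
  simp_rw [h, Finset.sum_add_distrib, ← Finset.mul_sum, hm]
  simp
  ring

lemma sum_sq_le_one {k : ℕ} {w : Fin k → ℝ} (hw : ∀ j, 0 ≤ w j) (hw1 : ∑ j, w j = 1) :
    ∑ j, w j ^ 2 ≤ 1 := by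
  rw [← hw1]
  refine Finset.sum_le_sum fun j _ => ?_
  have : w j ≤ 1 := hw1 ▸ Finset.single_le_sum (fun i _ => hw i) (Finset.mem_univ j)
  nlinarith [hw j]

lemma sq_sum_mul_le {k : ℕ} {w : Fin k → ℝ} (hw : ∀ j, 0 ≤ w j) (hw1 : ∑ j, w j = 1)
    (y : Fin k → ℝ) : (∑ j, w j * y j) ^ 2 ≤ ∑ j, y j ^ 2 := by
  refine (Finset.sum_mul_sq_le_sq_mul_sq _ _ _).trans ?_
  exact mul_le_of_le_one_left (Finset.sum_nonneg fun _ _ => sq_nonneg _)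
    (sum_sq_le_one hw hw1)

lemma centred_quadratic_form {k d : ℕ} (W : Matrix (Fin k) (Fin d) ℝ) (x : Fin k → ℝ) :
    x ⬝ᵥ (((d : ℝ)⁻¹ • (centred W * (centred W)ᵀ)) *ᵥ x) =
      (d : ℝ)⁻¹ * ∑ i, ((∑ j, W j i * x j) - (d : ℝ)⁻¹ * ∑ i', ∑ j, W j i' * x j) ^ 2 := by
  rw [Matrix.smul_mulVec, dotProduct_smul, smul_eq_mul, ← Matrix.mulVec_mulVec,
    Matrix.dotProduct_mulVec, ← Matrix.mulVec_transpose]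
  congr 1
  rw [dotProduct]
  refine Finset.sum_congr rfl fun i _ => ?_
  rw [← sq]
  congr 1
  simp only [centred, Matrix.mulVec, dotProduct, Matrix.transpose_apply, Matrix.sub_apply,
    Matrix.smul_apply, Matrix.mul_apply, Matrix.of_apply, mul_one, smul_eq_mul, sub_mul,
    Finset.sum_sub_distrib]
  congr 1
  rw [Finset.sum_comm, Finset.mul_sum]
  refine Finset.sum_congr rfl fun j _ => ?_
  rw [← Finset.sum_mul]
  ring

/-- The eigenvalue condition on the centred weights bounds the smallest eigenvalue of `W Wᵀ`: the
missing direction `1` is seen through `∑ j, W j i = 1`. -/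
lemma sum_sq_ge_of_centred {k d : ℕ} (hk : 1 ≤ k) (hd : 1 ≤ d) {W : Matrix (Fin k) (Fin d) ℝ}
    (hW : ∀ j i, 0 ≤ W j i) (hW1 : ∀ i, ∑ j, W j i = 1) {l : ℝ} (hl : 0 < l)
    (h : ∀ x : Fin k → ℝ, ∑ j, x j = 0 →
      l * (x ⬝ᵥ x) ≤ x ⬝ᵥ (((d : ℝ)⁻¹ • (centred W * (centred W)ᵀ)) *ᵥ x)) (x : Fin k → ℝ) :
    min 1 l / (4 * k) * d * ∑ j, x j ^ 2 ≤ ∑ i, (∑ j, W j i * x j) ^ 2 := by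
  have hk0 : (0 : ℝ) < k := by positivity
  have hk1 : (1 : ℝ) ≤ k := by exact_mod_cast hk
  have hd0 : (0 : ℝ) < d := by positivity
  set t : ℝ := (∑ j, x j) / k
  set y : Fin k → ℝ := fun j => x j - t
  have hy : ∑ j, y j = 0 := by
    simp [y, t, Finset.sum_sub_distrib]
    field_simp
    simp
  set z : Fin d → ℝ := fun i => ∑ j, W j i * y j
  set m : ℝ := (d : ℝ)⁻¹ * ∑ i, z i
  have hm : ∑ i, z i = Fintype.card (Fin d) * m := by
    simp [m, hd0.ne']
  have hx2 : ∑ j, x j ^ 2 = ∑ j, y j ^ 2 + k * t ^ 2 := by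
    have := sum_sq_add_const y 0 t (by simp [hy])
    simpa [y] using this
  have hxz : ∀ i, ∑ j, W j i * x j = z i + t := fun i => by
    have : ∀ j, W j i * x j = W j i * y j + W j i * t := fun j => by simp [y]; ring
    simp_rw [this, Finset.sum_add_distrib, ← Finset.sum_mul, hW1, one_mul, z]
  simp_rw [hxz]
  rw [sum_sq_add_const z m t hm, Fintype.card_fin, hx2]
  have h1 := h y hy
  rw [centred_quadratic_form, inv_mul_eq_div, le_div_iff₀ hd0] at h1
  have hyy : y ⬝ᵥ y = ∑ j, y j ^ 2 := by simp [dotProduct, sq]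
  rw [hyy] at h1
  change l * (∑ j, y j ^ 2) * d ≤ ∑ i, (z i - m) ^ 2 at h1
  set Y := ∑ j, y j ^ 2
  have hY : 0 ≤ Y := Finset.sum_nonneg fun _ _ => sq_nonneg _
  have hmY : m ^ 2 ≤ Y := by
    have h2 : ∀ i, z i ^ 2 ≤ Y := fun i => sq_sum_mul_le (fun j => hW j i) (hW1 i) y
    have h3 : (∑ i, z i) ^ 2 ≤ d * ∑ i, z i ^ 2 := by
      simpa using sq_sum_le_card_mul_sum_sq (s := Finset.univ) (f := z)
    have h4 : ∑ i, z i ^ 2 ≤ d * Y := by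
      simpa using Finset.sum_le_card_nsmul Finset.univ _ _ fun i _ => h2 i
    have h5 : m ^ 2 = (∑ i, z i) ^ 2 / d ^ 2 := by simp only [m]; field_simp
    rw [h5, div_le_iff₀ (by positivity)]
    nlinarith
  set l' := min 1 l
  have hl'0 : 0 < l' := lt_min one_pos hl
  have hl'1 : l' ≤ 1 := min_le_left _ _
  have hl'l : l' ≤ l := min_le_right _ _
  have h6 : l' / 2 * Y + l' / 4 * t ^ 2 ≤ l * Y + (m + t) ^ 2 := by
    have h7 : t ^ 2 ≤ 2 * (m + t) ^ 2 + 2 * m ^ 2 := by nlinarith [sq_nonneg (2 * m + t)]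
    have h8 : l' * t ^ 2 ≤ 2 * (m + t) ^ 2 + 2 * l' * Y := by
      have := mul_le_mul_of_nonneg_left h7 hl'0.le
      have h9 : l' * (m + t) ^ 2 ≤ (m + t) ^ 2 := mul_le_of_le_one_left (sq_nonneg _) hl'1
      have := mul_le_mul_of_nonneg_left hmY hl'0.le
      nlinarith
    have : l' * Y ≤ l * Y := mul_le_mul_of_nonneg_right hl'l hY
    nlinarith [sq_nonneg (m + t)]
  have h10 : l' / (4 * k) * (Y + k * t ^ 2) ≤ l' / 2 * Y + l' / 4 * t ^ 2 := by
    have h11 : l' / (4 * k) * (Y + k * t ^ 2) = l' / (4 * k) * Y + l' / 4 * t ^ 2 := by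
      field_simp
    rw [h11]
    have : l' / (4 * k) ≤ l' / 2 := by gcongr; linarith
    gcongr
  have h12 := mul_le_mul_of_nonneg_right (h10.trans h6) hd0.le
  nlinarith

lemma eq_zero_of_mul_sum_sq_nonpos {k : ℕ} {b : ℝ} (hb : 0 < b) {x : Fin k → ℝ}
    (h : b * ∑ j, x j ^ 2 ≤ 0) : x = 0 := by
  have h3 := (Finset.sum_eq_zero_iff_of_nonneg fun j _ => sq_nonneg (x j)).1
    ((nonpos_of_mul_nonpos_right h hb).antisymm (Finset.sum_nonneg fun _ _ => sq_nonneg _))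
  ext j
  simpa using h3 j (Finset.mem_univ j)

/-- A weight matrix with a lower bound on the spectrum of `W Wᵀ` has a right inverse with small
columns. -/
lemma exists_right_inverse {k d : ℕ} (hd : 1 ≤ d) {W : Matrix (Fin k) (Fin d) ℝ} {c : ℝ}
    (hc : 0 < c) (h : ∀ x : Fin k → ℝ, c * d * ∑ j, x j ^ 2 ≤ ∑ i, (∑ j, W j i * x j) ^ 2) :
    ∃ G : Matrix (Fin d) (Fin k) ℝ, W * G = 1 ∧ ∀ f, ∑ i, G i f ^ 2 ≤ 1 / (c * d) := by
  have hcd : 0 < c * d := by positivity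
  set A := W * Wᵀ
  have hA : ∀ x, x ⬝ᵥ (A *ᵥ x) = ∑ i, (∑ j, W j i * x j) ^ 2 := fun x => by
    rw [← Matrix.mulVec_mulVec, Matrix.dotProduct_mulVec, ← Matrix.mulVec_transpose]
    simp [dotProduct, Matrix.mulVec, sq]
  have hdet : IsUnit A.det := by
    rw [isUnit_iff_ne_zero]
    intro h0
    obtain ⟨x, hx, hAx⟩ := Matrix.exists_mulVec_eq_zero_iff.2 h0
    have h1 := h x
    rw [← hA, hAx, dotProduct_zero] at h1
    exact hx (eq_zero_of_mul_sum_sq_nonpos hcd h1)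
  refine ⟨Wᵀ * A⁻¹, ?_, fun f => ?_⟩
  · rw [← Matrix.mul_assoc, Matrix.mul_nonsing_inv _ hdet]
  · set g : Fin k → ℝ := A⁻¹ *ᵥ Pi.single f 1
    have hAg : A *ᵥ g = Pi.single f 1 := by
      rw [Matrix.mulVec_mulVec, Matrix.mul_nonsing_inv _ hdet, Matrix.one_mulVec]
    have hG : ∀ i, (Wᵀ * A⁻¹) i f = ∑ j, W j i * g j := fun i => by
      simp [g, Matrix.mul_apply]
    simp_rw [hG]
    rw [← hA, hAg, dotProduct_single_one]
    have h1 := h g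
    rw [← hA, hAg, dotProduct_single_one] at h1
    have h2 : g f ^ 2 ≤ ∑ j, g j ^ 2 :=
      Finset.single_le_sum (f := fun j => g j ^ 2) (fun _ _ => sq_nonneg _) (Finset.mem_univ f)
    have h3 : c * d * g f ^ 2 ≤ g f := (mul_le_mul_of_nonneg_left h2 hcd.le).trans h1
    rw [le_div_iff₀ hcd]
    by_contra! h4
    nlinarith

/-- If the convex combinations `Ĉ hᵢ` fit `C₀ wᵢ` in mean square, then the plane of `Ĉ` is close
to that of `C₀`: the least squares matrix `N` satisfies `Ĉ N ≈ C₀`. -/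
lemma exists_transition_matrix {V k d : ℕ} (hd : 1 ≤ d) {W H : Matrix (Fin k) (Fin d) ℝ} {c : ℝ}
    (hc : 0 < c) (hW1 : ∀ i, ∑ j, W j i = 1)
    (h : ∀ x : Fin k → ℝ, c * d * ∑ j, x j ^ 2 ≤ ∑ i, (∑ j, W j i * x j) ^ 2)
    (hH : ∀ j i, 0 ≤ H j i) (hH1 : ∀ i, ∑ j, H j i = 1) {C C₀ : Matrix (Fin V) (Fin k) ℝ} {S : ℝ}
    (hS : ∑ i, ∑ a, ((C * H) a i - (C₀ * W) a i) ^ 2 ≤ d * S) :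
    ∃ N : Matrix (Fin k) (Fin k) ℝ, (∀ f, ∑ j, N j f = 1) ∧ (∀ j f, N j f ^ 2 ≤ 1 / c) ∧
      ∀ a f, ((C * N) a f - C₀ a f) ^ 2 ≤ S / c := by
  obtain ⟨G, hWG, hG⟩ := exists_right_inverse hd hc h
  have hd0 : (0 : ℝ) < d := by positivity
  have hG0 : ∀ f, 0 ≤ ∑ i, G i f ^ 2 := fun f => Finset.sum_nonneg fun _ _ => sq_nonneg _
  refine ⟨H * G, fun f => ?_, fun j f => ?_, fun a f => ?_⟩
  · -- both `W` and `H` have column sums one, so `1ᵀ H G = 1ᵀ W G = 1ᵀ`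
    have h1 : ∀ M : Matrix (Fin k) (Fin d) ℝ, (∀ i, ∑ j, M j i = 1) →
        ∑ j, (M * G) j f = ∑ i, G i f := fun M hM => by
      simp only [Matrix.mul_apply]
      rw [Finset.sum_comm]
      simp [← Finset.sum_mul, hM]
    rw [h1 H hH1, ← h1 W hW1, hWG]
    simp [Matrix.one_apply]
  · rw [Matrix.mul_apply]
    have h2 : ∑ i, H j i ^ 2 ≤ d := by
      have : ∀ i, H j i ^ 2 ≤ 1 := fun i => by
        have : H j i ≤ 1 := hH1 i ▸ Finset.single_le_sum (f := fun j => H j i)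
          (fun b _ => hH b i) (Finset.mem_univ j)
        nlinarith [hH j i]
      simpa using Finset.sum_le_card_nsmul Finset.univ _ _ fun i _ => this i
    calc (∑ i, H j i * G i f) ^ 2 ≤ (∑ i, H j i ^ 2) * ∑ i, G i f ^ 2 :=
          Finset.sum_mul_sq_le_sq_mul_sq _ _ _
      _ ≤ d * (1 / (c * d)) := mul_le_mul h2 (hG f) (hG0 f) hd0.le
      _ = 1 / c := by field_simp
  · have h3 : (C * (H * G)) a f - C₀ a f = ∑ i, ((C * H) a i - (C₀ * W) a i) * G i f := by
      have : C₀ a f = (C₀ * W * G) a f := by rw [Matrix.mul_assoc, hWG, Matrix.mul_one]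
      rw [this, ← Matrix.mul_assoc, Matrix.mul_apply, Matrix.mul_apply, ← Finset.sum_sub_distrib]
      simp_rw [sub_mul]
    rw [h3]
    have h4 : ∑ i, ((C * H) a i - (C₀ * W) a i) ^ 2 ≤ d * S := by
      refine le_trans (Finset.sum_le_sum fun i _ => ?_) hS
      exact Finset.single_le_sum (f := fun a => ((C * H) a i - (C₀ * W) a i) ^ 2)
        (fun _ _ => sq_nonneg _) (Finset.mem_univ a)
    calc _ ≤ (∑ i, ((C * H) a i - (C₀ * W) a i) ^ 2) * ∑ i, G i f ^ 2 :=
          Finset.sum_mul_sq_le_sq_mul_sq _ _ _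
      _ ≤ (d * S) * (1 / (c * d)) := mul_le_mul h4 (hG f) (hG0 f)
          ((Finset.sum_nonneg fun _ _ => sq_nonneg _).trans h4)
      _ = S / c := by field_simp

/-! ### Consequences of maximality of the integrated likelihood -/

lemma mulVec_ge {V k : ℕ} {C : Matrix (Fin V) (Fin k) ℝ} {γ : ℝ} (hC : ∀ v f, γ ≤ C v f)
    {w : Fin k → ℝ} (hw : ∀ j, 0 ≤ w j) (hw1 : ∑ j, w j = 1) (v : Fin V) : γ ≤ (C *ᵥ w) v := by
  have h : ∑ j, γ * w j ≤ ∑ j, C v j * w j :=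
    Finset.sum_le_sum fun j _ => mul_le_mul_of_nonneg_right (hC v j) (hw j)
  rw [← Finset.mul_sum, hw1, mul_one] at h
  exact h

/-- A matrix that is at least as likely as the true one fits every document in mean square, up to
the noise level: by the Gibbs inequality, a bad fit costs more than the polynomial factors that
averaging over the simplex can gain. -/
lemma exists_fit {V k n d : ℕ} (hk : 1 ≤ k) (hn : 2 ≤ n) {C C₀ : Matrix (Fin V) (Fin k) ℝ} {γ E : ℝ}
    (hγ : 0 < γ) (hC : IsColumnStochastic C) (hC₀ : IsColumnStochastic C₀)
    (hC₀γ : ∀ v f, γ ≤ C₀ v f) (X : Fin d → Fin n → Fin V)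
    (hF : integratedLikelihood C₀ X ≤ integratedLikelihood C X)
    (w : Fin d → EuclideanSpace ℝ (Fin k)) (hw : ∀ i, w i ∈ simplex k)
    (hE : ∀ i, ∑ a, (wordFreq (X i) a - (C₀ *ᵥ (w i).ofLp) a) ^ 2 ≤ E) :
    ∃ h : Fin d → EuclideanSpace ℝ (Fin k), (∀ i, h i ∈ simplex k) ∧
      ∑ i, ∑ a, ((C *ᵥ (h i).ofLp) a - (C₀ *ᵥ (w i).ofLp) a) ^ 2 ≤
        d * (16 * k * (Real.log n / n) + 16 * E / γ) := by
  have := isProbabilityMeasure_uniformSimplex hk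
  have hn0 : (0 : ℝ) < n := by positivity
  have hex : ∀ i, ∃ y ∈ simplex k, ∫ v, likelihood (X i) (C *ᵥ v.ofLp) ∂(uniformSimplex k) ≤
      likelihood (X i) (C *ᵥ y.ofLp) := fun i => by
    obtain ⟨y, hy, hle⟩ := exists_notMem_null_integral_le
      (integrable_likelihood hk (X i) C) (uniformSimplex_compl k)
    exact ⟨y, by simpa using hy, hle⟩
  choose h hh hle using hex
  refine ⟨h, hh, ?_⟩
  set D : Fin d → ℝ := fun i => ∑ a, ((C *ᵥ (h i).ofLp) a - (C₀ *ᵥ (w i).ofLp) a) ^ 2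
  have hL : ∀ i, 0 < likelihood (X i) (C₀ *ᵥ (w i).ofLp) := fun i =>
    likelihood_pos _ fun a => hγ.trans_le (mulVec_ge hC₀γ (hw i).1 (hw i).2 a)
  have hup : ∀ i, ∫ v, likelihood (X i) (C *ᵥ v.ofLp) ∂(uniformSimplex k) ≤
      likelihood (X i) (C₀ *ᵥ (w i).ofLp) * Real.exp (n * (2 / γ * E - D i / 8)) := fun i => by
    refine (hle i).trans ((likelihood_le (by omega) (X i) hγ (mulVec_nonneg hC.1 (hh i).1)
      ((sum_mulVec_of_colSum hC.2 _).trans (hh i).2)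
      (mulVec_ge hC₀γ (hw i).1 (hw i).2)
      ((sum_mulVec_of_colSum hC₀.2 _).trans (hw i).2)).trans ?_)
    have := hE i
    have := (hL i).le
    gcongr
  have h1 : ∏ i, (Real.exp (-(2 * k * Real.log n)) * likelihood (X i) (C₀ *ᵥ (w i).ofLp)) ≤
      ∏ i, (likelihood (X i) (C₀ *ᵥ (w i).ofLp) * Real.exp (n * (2 / γ * E - D i / 8))) :=
    (Finset.prod_le_prod (fun i _ => mul_nonneg (Real.exp_pos _).le (hL i).le) fun i _ =>
      integral_likelihood_ge hk hn (X i) hC₀ (hw i)).trans (hF.trans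
      (Finset.prod_le_prod (fun i _ => integral_likelihood_nonneg (X i) hC) fun i _ => hup i))
  rw [Finset.prod_mul_distrib, Finset.prod_mul_distrib, mul_comm (∏ _, Real.exp _),
    mul_le_mul_iff_right₀ (Finset.prod_pos fun i _ => hL i), ← Real.exp_sum, ← Real.exp_sum,
    Real.exp_le_exp, ← Finset.mul_sum, Finset.sum_sub_distrib, ← Finset.sum_div] at h1
  simp only [Finset.sum_const, Finset.card_univ, Fintype.card_fin, nsmul_eq_mul] at h1
  have h2 : (n : ℝ) * ∑ i, D i ≤ n * (d * (16 * k * (Real.log n / n) + 16 * E / γ)) := by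
    have h3 : (n : ℝ) * (d * (16 * k * (Real.log n / n) + 16 * E / γ)) =
        8 * (n * (d * (2 / γ * E)) + d * (2 * k * Real.log n)) := by field_simp; ring
    rw [h3]
    linarith
  exact le_of_mul_le_mul_left h2 hn0

lemma sum_sq_mulVec_le {V k : ℕ} {A : Matrix (Fin V) (Fin k) ℝ} {S : ℝ}
    (hA : ∀ a f, A a f ^ 2 ≤ S) (x : Fin k → ℝ) :
    ∑ a, (A *ᵥ x) a ^ 2 ≤ V * k * S * ∑ f, x f ^ 2 := by
  have h : ∀ a, (A *ᵥ x) a ^ 2 ≤ k * S * ∑ f, x f ^ 2 := fun a => by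
    refine (Finset.sum_mul_sq_le_sq_mul_sq Finset.univ (fun f => A a f) x).trans ?_
    refine mul_le_mul_of_nonneg_right ?_ (Finset.sum_nonneg fun _ _ => sq_nonneg _)
    simpa using Finset.sum_le_card_nsmul Finset.univ _ _ fun f _ => hA a f
  calc _ ≤ ∑ _a : Fin V, k * S * ∑ f, x f ^ 2 := Finset.sum_le_sum fun a _ => h a
    _ = _ := by simp; ring

lemma sum_add_sq_le {ι : Type*} (s : Finset ι) (f g : ι → ℝ) :
    ∑ a ∈ s, (f a + g a) ^ 2 ≤ 2 * ∑ a ∈ s, f a ^ 2 + 2 * ∑ a ∈ s, g a ^ 2 := by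
  rw [Finset.mul_sum, Finset.mul_sum, ← Finset.sum_add_distrib]
  exact Finset.sum_le_sum fun a _ => by nlinarith [sq_nonneg (f a - g a)]

lemma colSum_mul {m V k : ℕ} {A : Matrix (Fin m) (Fin V) ℝ} {B : Matrix (Fin V) (Fin k) ℝ}
    (hA : ∀ f, ∑ j, A j f = 1) (hB : ∀ f, ∑ j, B j f = 1) (f : Fin k) :
    ∑ j, (A * B) j f = 1 := by
  have h := sum_mulVec_of_colSum hA (fun j => B j f)
  rw [hB] at h
  simpa [Matrix.mul_apply, Matrix.mulVec, dotProduct] using h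

lemma isUnit_det_of_mul {V k : ℕ} {C : Matrix (Fin V) (Fin k) ℝ} {N : Matrix (Fin k) (Fin k) ℝ}
    {s₁ : ℝ} (hs₁ : 0 < s₁)
    (hinj : ∀ x : Fin k → ℝ, s₁ * ∑ f, x f ^ 2 ≤ ∑ a, ((C * N) *ᵥ x) a ^ 2) : IsUnit N.det := by
  rw [isUnit_iff_ne_zero]
  intro h0
  obtain ⟨x, hx, hNx⟩ := Matrix.exists_mulVec_eq_zero_iff.2 h0
  have h1 := hinj x
  rw [← Matrix.mulVec_mulVec, hNx] at h1
  exact hx (eq_zero_of_mul_sum_sq_nonpos hs₁ (by simpa using h1))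

/-- A matrix `C` with `C N` injective is itself bounded below, if `N` is bounded. -/
lemma mul_sum_sq_le_of_mul {V k : ℕ} {C : Matrix (Fin V) (Fin k) ℝ} {N : Matrix (Fin k) (Fin k) ℝ}
    {b s₁ : ℝ} (hs₁ : 0 < s₁) (hN : ∀ j f, N j f ^ 2 ≤ b)
    (hinj : ∀ x : Fin k → ℝ, s₁ * ∑ f, x f ^ 2 ≤ ∑ a, ((C * N) *ᵥ x) a ^ 2) (u : Fin k → ℝ) :
    s₁ * ∑ j, u j ^ 2 ≤ k * k * b * ∑ a, (C *ᵥ u) a ^ 2 := by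
  rcases Nat.eq_zero_or_pos k with rfl | hk
  · simp
  have hb : 0 ≤ b := (sq_nonneg _).trans (hN ⟨0, hk⟩ ⟨0, hk⟩)
  have hdet : IsUnit N.det := isUnit_det_of_mul hs₁ hinj
  set y := N⁻¹ *ᵥ u
  have hNy : N *ᵥ y = u := by
    rw [Matrix.mulVec_mulVec, Matrix.mul_nonsing_inv _ hdet, Matrix.one_mulVec]
  have h1 := hinj y
  rw [← Matrix.mulVec_mulVec, hNy] at h1
  have h2 := sum_sq_mulVec_le hN y
  rw [hNy] at h2
  calc s₁ * ∑ j, u j ^ 2 ≤ s₁ * (k * k * b * ∑ f, y f ^ 2) := by gcongr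
    _ = k * k * b * (s₁ * ∑ f, y f ^ 2) := by ring
    _ ≤ _ := by gcongr

/-- If the columns of `Ĉ N` are nearly those of `C₀`, then `|det N|` is nearly at least one, since
otherwise the slightly enlarged simplex with vertices in the plane of `Ĉ` and near `C₀` would have
smaller volume than `conv Ĉ`, and hence a larger integrated likelihood. The enlargement by `τ`
is large enough for the averages of all the document likelihoods to concentrate inside it. -/
lemma det_transition_ge {V k n d : ℕ} (hk : 1 ≤ k) (hn : 2 ≤ n) (hd : 1 ≤ d)
    {C : Matrix (Fin V) (Fin k) ℝ} {N : Matrix (Fin k) (Fin k) ℝ} {γ E s₁ τ : ℝ}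
    (hγ : 0 < γ) (hs₁ : 0 < s₁) (X : Fin d → Fin n → Fin V) (hC : IsMLE X C)
    (hN1 : ∀ f, ∑ j, N j f = 1) (hCN : ∀ a f, γ ≤ (C * N) a f)
    (hinj : ∀ x : Fin k → ℝ, s₁ * ∑ f, x f ^ 2 ≤ ∑ a, ((C * N) *ᵥ x) a ^ 2)
    (w : Fin d → EuclideanSpace ℝ (Fin k)) (hw : ∀ i, w i ∈ simplex k)
    (hE : ∀ i, ∑ a, (wordFreq (X i) a - ((C * N) *ᵥ (w i).ofLp) a) ^ 2 ≤ E)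
    (hτ0 : 0 ≤ τ) (hτγ : τ ≤ γ)
    (hτ : (2 * k + 1) * (Real.log n / n) + 2 / γ * E ≤ s₁ * (τ / k) ^ 2 / 8) :
    1 - 1 / n - k * τ ≤ |N.det| := by
  have hk0 : (0 : ℝ) < k := by positivity
  have hn0 : (0 : ℝ) < n := by positivity
  have hdet : IsUnit N.det := isUnit_det_of_mul hs₁ hinj
  have hCNs : ∀ f, ∑ a, (C * N) a f = 1 := colSum_mul hC.1.2 hN1
  have hCN1 : ∀ a f, (C * N) a f ≤ 1 := fun a f => by
    rw [← hCNs f]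
    exact Finset.single_le_sum (f := fun a => (C * N) a f) (fun b _ => hγ.le.trans (hCN b f))
      (Finset.mem_univ a)
  set c : Fin k → ℝ := fun _ => 1 / k
  have hc1 : ∑ j, c j = 1 := by simp [c, hk0.ne']
  set M := homothety c (1 + τ)
  have hM1 : ∀ f, ∑ j, M j f = 1 := homothety_colSum hc1 _
  set T := N * M
  have hT1 : ∀ f, ∑ j, T j f = 1 := colSum_mul hN1 hM1
  have hCT : IsColumnStochastic (C * T) := by
    refine ⟨fun a f => ?_, colSum_mul hC.1.2 hT1⟩
    · have h1 : (C * T) a f = (1 + τ) * (C * N) a f - τ * ∑ j, (C * N) a j * c j := by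
        rw [← Matrix.mul_assoc, Matrix.mul_apply]
        simp only [M, homothety, Matrix.add_apply, Matrix.smul_apply, Matrix.one_apply,
          Matrix.of_apply, smul_eq_mul, mul_add, Finset.sum_add_distrib]
        simp [Finset.mul_sum, c]
        ring_nf
        simp only [sub_right_inj]
        exact Finset.sum_congr rfl fun _ _ => by ring
      have h2 : ∑ j, (C * N) a j * c j ≤ 1 := by
        rw [← hc1]
        exact Finset.sum_le_sum fun j _ =>
          mul_le_of_le_one_left (by simp [c]) (hCN1 a j)
      have := hCN a f
      have := mul_le_mul_of_nonneg_left h2 hτ0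
      have := mul_nonneg hτ0 (hγ.le.trans (hCN a f))
      rw [h1]
      linarith
  set g : Fin d → ℝ := fun i => likelihood (X i) ((C * N) *ᵥ (w i).ofLp)
  have hqγ : ∀ i a, γ ≤ ((C * N) *ᵥ (w i).ofLp) a := fun i => mulVec_ge hCN (hw i).1 (hw i).2
  have hg : ∀ i, 0 < g i := fun i => likelihood_pos _ fun a => hγ.trans_le (hqγ i a)
  set I : Matrix (Fin V) (Fin k) ℝ → Fin d → ℝ := fun D i =>
    ∫ v, likelihood (X i) (D *ᵥ v.ofLp) ∂(uniformSimplex k)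
  -- `w i` lies in the enlarged simplex, so its likelihood bounds the average over it from below
  have hlow : ∀ i, Real.exp (-(2 * k * Real.log n)) * g i ≤ I (C * T) i := fun i => by
    set y : EuclideanSpace ℝ (Fin k) :=
      WithLp.toLp 2 (fun j => (w i j + τ * (1 / k)) / (1 + τ)) with hy
    have hyΔ : y ∈ simplex k := by
      refine ⟨fun j => ?_, ?_⟩
      · have := (hw i).1 j
        simp only [hy]
        positivity
      · simp only [hy]
        rw [← Finset.sum_div, Finset.sum_add_distrib, (hw i).2]
        simp
        field_simp
    have hMy : M *ᵥ y.ofLp = (w i).ofLp := by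
      ext j
      rw [homothety_mulVec _ _ _ hyΔ.2]
      simp only [hy, c]
      field_simp
      ring
    have h := integral_likelihood_ge hk hn (X i) hCT hyΔ
    rwa [← Matrix.mul_assoc, ← Matrix.mulVec_mulVec, hMy, Matrix.mul_assoc] at h
  have hIpos : ∀ i, 0 < I (C * T) i := fun i =>
    (mul_pos (Real.exp_pos _) (hg i)).trans_le (hlow i)
  have hup : ∀ i, I C i ≤ (|T.det| + 1 / n) * I (C * T) i := fun i => by
    have h := integral_likelihood_le hk (X i) hT1 hCT (B := I (C * T) i / n)
      (div_nonneg (hIpos i).le hn0.le) ?_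
    · exact h.trans_eq (by simp only [I]; ring)
    intro u hu huT
    -- in the coordinates of `Ĉ N`, the point `u` is `v`, outside the enlarged simplex
    set v : Fin k → ℝ := N⁻¹ *ᵥ u.ofLp
    have hNv : N *ᵥ v = u.ofLp := by
      rw [Matrix.mulVec_mulVec, Matrix.mul_nonsing_inv _ hdet, Matrix.one_mulVec]
    have hv1 : ∑ j, v j = 1 := by
      rw [← hu.2, ← hNv, sum_mulVec_of_colSum hN1]
    have hvj : ∃ j, v j < -(τ / k) := by
      by_contra! hcon
      apply huT
      set y : EuclideanSpace ℝ (Fin k) :=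
        WithLp.toLp 2 (fun j => (v j + τ * (1 / k)) / (1 + τ)) with hy
      have hyΔ : y ∈ simplex k := by
        refine ⟨fun j => ?_, ?_⟩
        · have h1 := hcon j
          have h2 : 0 ≤ v j + τ * (1 / k) := by
            rw [mul_one_div]; linarith
          simp only [hy]
          positivity
        · simp only [hy]
          rw [← Finset.sum_div, Finset.sum_add_distrib, hv1]
          simp
          field_simp
      refine ⟨y, hyΔ, ?_⟩
      have hMy : M *ᵥ y.ofLp = v := by
        ext j
        rw [homothety_mulVec _ _ _ hyΔ.2]
        simp only [hy, c]
        field_simp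
        ring
      apply WithLp.ofLp_injective 2
      rw [toEuclideanLin_ofLp, ← Matrix.mulVec_mulVec, hMy, hNv]
    obtain ⟨j, hj⟩ := hvj
    have hdist : s₁ * (τ / k) ^ 2 ≤
        ∑ a, ((C *ᵥ u.ofLp) a - ((C * N) *ᵥ (w i).ofLp) a) ^ 2 := by
      have h1 := hinj (v - (w i).ofLp)
      have h2 : (C * N) *ᵥ (v - (w i).ofLp) = C *ᵥ u.ofLp - (C * N) *ᵥ (w i).ofLp := by
        rw [Matrix.mulVec_sub, ← Matrix.mulVec_mulVec, hNv]
      rw [h2] at h1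
      refine le_trans (mul_le_mul_of_nonneg_left ?_ hs₁.le) h1
      have h3 : (τ / k) ^ 2 ≤ (v - (w i).ofLp) j ^ 2 := by
        have := (hw i).1 j
        have h4 : 0 ≤ τ / k := by positivity
        simp only [Pi.sub_apply]
        nlinarith
      exact h3.trans (Finset.single_le_sum (f := fun j => (v - (w i).ofLp) j ^ 2)
        (fun _ _ => sq_nonneg _) (Finset.mem_univ j))
    have h5 := likelihood_le (by omega) (X i) hγ (mulVec_nonneg hC.1.1 hu.1)
      ((sum_mulVec_of_colSum hC.1.2 _).trans hu.2) (hqγ i)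
      ((sum_mulVec_of_colSum hCNs _).trans (hw i).2)
    refine h5.trans ?_
    have h6 : (n : ℝ) * (2 / γ * ∑ a, (wordFreq (X i) a - ((C * N) *ᵥ (w i).ofLp) a) ^ 2 -
        (∑ a, ((C *ᵥ u.ofLp) a - ((C * N) *ᵥ (w i).ofLp) a) ^ 2) / 8) ≤
        -(2 * k * Real.log n) + -Real.log n := by
      have h7 : 2 / γ * ∑ a, (wordFreq (X i) a - ((C * N) *ᵥ (w i).ofLp) a) ^ 2 ≤ 2 / γ * E := by
        have := hE i
        gcongr
      have h8 : 2 / γ * ∑ a, (wordFreq (X i) a - ((C * N) *ᵥ (w i).ofLp) a) ^ 2 -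
        (∑ a, ((C *ᵥ u.ofLp) a - ((C * N) *ᵥ (w i).ofLp) a) ^ 2) / 8 ≤
          -((2 * k + 1) * (Real.log n / n)) := by linarith
      refine (mul_le_mul_of_nonneg_left h8 hn0.le).trans_eq ?_
      field_simp
      ring
    have h9 : Real.exp (-Real.log n) = 1 / n := by
      rw [Real.exp_neg, Real.exp_log hn0, one_div]
    calc g i * _ ≤ g i * Real.exp (-(2 * k * Real.log n) + -Real.log n) := by
          have := (hg i).le
          gcongr
      _ = (Real.exp (-(2 * k * Real.log n)) * g i) / n := by rw [Real.exp_add, h9]; ring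
      _ ≤ _ := by
          have := hlow i
          gcongr
  have hF : ∏ i, I (C * T) i ≤ ∏ i, ((|T.det| + 1 / n) * I (C * T) i) :=
    (hC.2 _ hCT).trans (Finset.prod_le_prod
      (fun i _ => integral_likelihood_nonneg (X i) hC.1) fun i _ => hup i)
  rw [Finset.prod_mul_distrib, Finset.prod_const, Finset.card_univ, Fintype.card_fin,
    le_mul_iff_one_le_left (Finset.prod_pos fun i _ => hIpos i)] at hF
  have hone : 1 ≤ |T.det| + 1 / n := by
    by_contra! hlt
    exact absurd hF (not_le.2 (pow_lt_one₀ (by positivity) hlt (by omega)))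
  have hTdet : |T.det| = |N.det| * (1 + τ) ^ (k - 1) := by
    rw [Matrix.det_mul, det_homothety hk hc1 (by positivity), abs_mul,
      abs_of_nonneg (a := (1 + τ) ^ (k - 1)) (by positivity)]
  have hpow : (1 + τ) ^ (k - 1) ≤ Real.exp (k * τ) := by
    calc (1 + τ) ^ (k - 1) ≤ (1 + τ) ^ k := pow_le_pow_right₀ (by linarith) (by omega)
      _ ≤ Real.exp τ ^ k := by
          gcongr
          linarith [Real.add_one_le_exp τ]
      _ = _ := by rw [← Real.exp_nat_mul]
  have h1 : 1 - 1 / (n : ℝ) ≤ |N.det| * Real.exp (k * τ) := by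
    have := mul_le_mul_of_nonneg_left hpow (abs_nonneg N.det)
    rw [hTdet] at hone
    linarith
  have h2 : (1 - 1 / (n : ℝ)) * Real.exp (-(k * τ)) ≤ |N.det| := by
    rw [Real.exp_neg, ← div_eq_mul_inv, div_le_iff₀ (Real.exp_pos _)]
    exact h1
  have h3 := Real.add_one_le_exp (-(k * τ))
  have h4 : 0 ≤ 1 - 1 / (n : ℝ) := by
    rw [sub_nonneg, div_le_one hn0]
    exact_mod_cast (by omega : 1 ≤ n)
  have h5 := mul_le_mul_of_nonneg_left h3 h4
  have h6 : 0 ≤ 1 / (n : ℝ) * (k * τ) := by positivity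
  linarith [h5.trans h2]

/-! ### The geometry of sufficiently scattered points -/

/-- Hadamard's inequality for the rows of a matrix. -/
lemma abs_det_le_prod_norm {k : ℕ} (N : Matrix (Fin k) (Fin k) ℝ) :
    |N.det| ≤ ∏ j, ‖(WithLp.toLp 2 (N j) : EuclideanSpace ℝ (Fin k))‖ := by
  have : Fact (Module.finrank ℝ (EuclideanSpace ℝ (Fin k)) = k) := ⟨by simp⟩
  let b := EuclideanSpace.basisFun (Fin k) ℝ
  have h := b.toBasis.orientation.abs_volumeForm_apply_le
    (fun j => (WithLp.toLp 2 (N j) : EuclideanSpace ℝ (Fin k)))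
  rw [b.toBasis.orientation.volumeForm_robust' b] at h
  refine le_of_eq_of_le ?_ h
  rw [Module.Basis.det_apply, ← Matrix.det_transpose N]
  congr 2

/-- If all points have weights summing to one and `xᵀ w ≥ -ρ` for each of them, then
condition (S1), applied to `x + ρ 1`, puts `x` into the second order cone up to `2 k ρ`. -/
lemma norm_le_of_inner_ge {k s : ℕ} {w : Fin s → EuclideanSpace ℝ (Fin k)} {ρ : ℝ}
    (hρ : 0 ≤ ρ) (hw : ∀ i, w i ∈ simplex k) (hSS : dualCone (cone w) ⊆ secondOrderCone k)
    (x : EuclideanSpace ℝ (Fin k)) (hx : ∀ i, -ρ ≤ inner ℝ x (w i)) :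
    ‖x‖ ≤ ∑ j, x j + 2 * k * ρ := by
  set o : EuclideanSpace ℝ (Fin k) := WithLp.toLp 2 fun _ => (1 : ℝ)
  have ho : ‖o‖ ≤ k := by
    rw [EuclideanSpace.norm_eq]
    simp only [o, norm_one, one_pow, Finset.sum_const, Finset.card_univ, Fintype.card_fin,
      nsmul_eq_mul, mul_one]
    rw [Real.sqrt_le_left (by positivity)]
    rcases Nat.eq_zero_or_pos k with rfl | h
    · simp
    · have : (1 : ℝ) ≤ k := by exact_mod_cast h
      nlinarith
  have how : ∀ i, inner ℝ o (w i) = (1 : ℝ) := fun i => by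
    rw [← (hw i).2, PiLp.inner_apply]
    simp [o]
  have hmem : x + ρ • o ∈ dualCone (cone w) := by
    rintro _ ⟨c, hc, rfl⟩
    rw [inner_sum]
    refine Finset.sum_nonneg fun i _ => ?_
    rw [inner_smul_right, inner_add_left, inner_smul_left, how]
    have := hx i
    exact mul_nonneg (hc i) (by simp; linarith)
  have h1 : ‖x + ρ • o‖ ≤ ∑ j, (x + ρ • o) j := hSS hmem
  have h2 : ∑ j, (x + ρ • o) j = ∑ j, x j + k * ρ := by
    simp [o, Finset.sum_add_distrib]
  have h3 : ‖x‖ ≤ ‖x + ρ • o‖ + ‖ρ • o‖ := by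
    simpa using norm_sub_le (x + ρ • o) (ρ • o)
  have h4 : ‖ρ • o‖ ≤ ρ * k := by
    rw [norm_smul, Real.norm_of_nonneg hρ]
    gcongr
  linarith

/-- The rows of a matrix with column sums one, with determinant nearly one and that lie nearly in
the second order cone, lie near its boundary: the product of the row norms is at least the
determinant by Hadamard's inequality, whereas their sum is at most nearly `k`. -/
lemma norm_ge_of_det_ge {k : ℕ} (hk : 1 ≤ k) {N : Matrix (Fin k) (Fin k) ℝ} {ρ : ℝ} (hρ : 0 ≤ ρ)
    (hρ2 : ρ ≤ 1 / 2) (hN1 : ∀ f, ∑ j, N j f = 1)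
    (hle : ∀ j, ‖(WithLp.toLp 2 (N j) : EuclideanSpace ℝ (Fin k))‖ ≤ ∑ f, N j f + 2 * k * ρ)
    (hdet : 1 - ρ ≤ |N.det|) (j : Fin k) :
    ∑ f, N j f ≤ ‖(WithLp.toLp 2 (N j) : EuclideanSpace ℝ (Fin k))‖ + 4 * k ^ 2 * ρ := by
  set b : Fin k → ℝ := fun j => ‖(WithLp.toLp 2 (N j) : EuclideanSpace ℝ (Fin k))‖
  have hk1 : (1 : ℝ) ≤ k := by exact_mod_cast hk
  have h1 : ∏ j, b j ≤ Real.exp (∑ j, (b j - 1)) := by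
    rw [Real.exp_sum]
    exact Finset.prod_le_prod (fun j _ => norm_nonneg _) fun j _ => by
      linarith [Real.add_one_le_exp (b j - 1)]
  have hsum : ∑ j, ∑ f, N j f = k := by
    refine (Finset.sum_comm (f := fun j f => N j f)).trans ?_
    simp [hN1]
  have h2 : ∑ f, N j f + 2 * k * ρ - b j ≤ ∑ i, (∑ f, N i f + 2 * k * ρ - b i) :=
    Finset.single_le_sum (f := fun i => ∑ f, N i f + 2 * k * ρ - b i)
      (fun i _ => sub_nonneg.2 (hle i)) (Finset.mem_univ j)
  have h3 : ∑ i, (∑ f, N i f + 2 * k * ρ - b i) = 2 * k ^ 2 * ρ - ∑ j, (b j - 1) := by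
    simp only [Finset.sum_sub_distrib, Finset.sum_add_distrib, hsum]
    simp
    ring
  have h4 : Real.exp (-(2 * ρ)) ≤ 1 - ρ := by
    rw [Real.exp_neg, inv_le_comm₀ (Real.exp_pos _) (by linarith)]
    have h5 := Real.add_one_le_exp (2 * ρ)
    have h6 : (1 - ρ)⁻¹ ≤ 2 * ρ + 1 := by
      rw [inv_le_iff_one_le_mul₀ (by linarith)]
      nlinarith
    linarith
  have h7 : -(2 * ρ) ≤ ∑ j, (b j - 1) :=
    Real.exp_le_exp.1 ((h4.trans hdet).trans ((abs_det_le_prod_norm N).trans h1))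
  have h8 : ρ ≤ k ^ 2 * ρ := le_mul_of_one_le_left hρ (one_le_pow₀ hk1)
  have h9 : 0 ≤ k * ρ := by positivity
  change _ ≤ b j + _
  linarith

/-- The rows of the transition matrix satisfy the hypotheses of condition (S3), hence lie near the
axes; as the columns sum to one, the matrix is close to a permutation matrix. -/
lemma exists_perm_near {k : ℕ} (hk : 1 ≤ k) {K : ℝ} (hK : 1 ≤ K) {s : ℕ}
    {w : Fin s → EuclideanSpace ℝ (Fin k)} {α β ρ : ℝ} (hw : ∀ i, w i ∈ simplex k)
    (hSS : IsSS w α β) {N : Matrix (Fin k) (Fin k) ℝ} (hN1 : ∀ f, ∑ j, N j f = 1)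
    (hNK : ∀ j f, |N j f| ≤ K) (hNw : ∀ i j, -ρ ≤ (N *ᵥ (w i).ofLp) j)
    (hdet : 1 - ρ ≤ |N.det|) (hρ : 0 ≤ ρ) (hρ2 : ρ ≤ 1 / 2)
    (hα : 8 * k ^ 2 * (k * K) ^ k * ρ ≤ α) (hβ : β ≤ 1 / (4 * k * (k * K))) :
    ∃ π : Equiv.Perm (Fin k), ∀ j f, |N j f - π.permMatrix ℝ j f| ≤ 4 * k * (k * K) * β := by
  have hk1 : (1 : ℝ) ≤ k := by exact_mod_cast hk
  set B : ℝ := k * K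
  have hB1 : 1 ≤ B := one_le_mul_of_one_le_of_one_le hk1 hK
  have hβ0 := hSS.beta_nonneg
  have hα0 := hSS.alpha_nonneg
  set x : Fin k → EuclideanSpace ℝ (Fin k) := fun j => WithLp.toLp 2 (N j)
  have hinner : ∀ j i, inner ℝ (x j) (w i) = (N *ᵥ (w i).ofLp) j := fun j i => by
    rw [PiLp.inner_apply]
    simp [x, Matrix.mulVec, dotProduct, mul_comm]
  have hle : ∀ j, ‖x j‖ ≤ ∑ f, N j f + 2 * k * ρ := fun j =>
    norm_le_of_inner_ge hρ hw hSS.dualCone_subset (x j) fun i => by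
      rw [hinner]; exact hNw i j
  have hge := norm_ge_of_det_ge hk hρ hρ2 hN1 hle hdet
  have hxB : ∀ j, ‖x j‖ ≤ B := fun j => by
    rw [EuclideanSpace.norm_eq, Real.sqrt_le_left (by positivity)]
    have h1 : ∀ f, ‖(x j) f‖ ^ 2 ≤ K ^ 2 := fun f => by
      rw [Real.norm_eq_abs]
      exact pow_le_pow_left₀ (abs_nonneg _) (hNK j f) 2
    calc ∑ f, ‖(x j) f‖ ^ 2 ≤ k * K ^ 2 := by
          simpa using Finset.sum_le_card_nsmul Finset.univ _ _ fun f _ => h1 f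
      _ ≤ B ^ 2 := by
          simp only [B, mul_pow]
          gcongr
          nlinarith
  have hlow : ∀ j, 1 / (2 * B ^ k) ≤ ‖x j‖ := fun j => by
    have h1 : (1 : ℝ) / 2 ≤ ∏ i, ‖x i‖ := by
      have := abs_det_le_prod_norm N
      have h2 : 1 / 2 ≤ |N.det| := by linarith
      exact h2.trans this
    rw [← Finset.mul_prod_erase _ _ (Finset.mem_univ j)] at h1
    have h3 : ∏ i ∈ Finset.univ.erase j, ‖x i‖ ≤ B ^ k := by
      calc _ ≤ ∏ _i ∈ Finset.univ.erase j, B :=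
            Finset.prod_le_prod (fun _ _ => norm_nonneg _) fun i _ => hxB i
        _ ≤ B ^ k := by
            rw [Finset.prod_const]
            refine pow_le_pow_right₀ hB1 ?_
            simp
    have h4 := h1.trans (mul_le_mul_of_nonneg_left h3 (norm_nonneg (x j)))
    rw [div_le_iff₀ (by positivity)]
    linarith
  have hαx : ∀ j, 4 * k ^ 2 * ρ ≤ α * ‖x j‖ := fun j => by
    have h1 : (8 * k ^ 2 * B ^ k * ρ) * (1 / (2 * B ^ k)) ≤ α * ‖x j‖ :=
      mul_le_mul hα (hlow j) (by positivity) hα0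
    refine le_of_eq_of_le ?_ h1
    field_simp
    ring
  have hkρ : k * ρ ≤ k ^ 2 * ρ := by
    gcongr
    nlinarith
  have hρk : ρ ≤ k * ρ := le_mul_of_one_le_left hρ hk1
  have hnear : ∀ j, x j ∈ nearAxes k β := fun j => by
    apply hSS.enlarged_subset
    have h1 := hαx j
    refine ⟨fun i => ?_, ?_⟩
    · rw [hinner]
      have := hNw i j
      linarith
    · have h2 : |‖x j‖ - ∑ f, N j f| ≤ α * ‖x j‖ := by
        have h3 := hle j
        have h4 : ∑ f, N j f ≤ ‖x j‖ + 4 * k ^ 2 * ρ := hge j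
        rw [abs_le]
        constructor <;> linarith
      exact h2
  choose g t ht0 ht using hnear
  have hβ4 : 4 * k * B * β ≤ 1 := by
    rw [le_div_iff₀ (by positivity)] at hβ
    linarith
  have hBβ : B * β ≤ k * (B * β) := le_mul_of_one_le_left (by positivity) hk1
  have hβB : β ≤ B * β := le_mul_of_one_le_left hβ0 hB1
  have hβ2 : β ≤ 1 / 2 := by linarith
  have htB : ∀ j, t j ≤ 2 * B := fun j => by
    have h1 : ‖t j • EuclideanSpace.single (g j) (1 : ℝ)‖ = t j := by
      rw [norm_smul, PiLp.norm_single, norm_one, mul_one, Real.norm_of_nonneg (ht0 j)]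
    have h2 := norm_sub_norm_le (t j • EuclideanSpace.single (g j) (1 : ℝ)) (x j)
    rw [norm_sub_rev, h1] at h2
    have h3 := ht j
    have h4 : β * t j ≤ 1 / 2 * t j := mul_le_mul_of_nonneg_right hβ2 (ht0 j)
    have := hxB j
    linarith
  have hent : ∀ j m, |N j m - if m = g j then t j else 0| ≤ 2 * B * β := fun j m => by
    have h1 := (PiLp.norm_apply_le (x j - t j • EuclideanSpace.single (g j) (1 : ℝ)) m).trans
      (ht j)
    have h2 : (x j - t j • EuclideanSpace.single (g j) (1 : ℝ)) m =
        N j m - if m = g j then t j else 0 := by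
      simp [x]
    rw [h2, Real.norm_eq_abs] at h1
    have := mul_le_mul_of_nonneg_left (htB j) hβ0
    linarith
  have hcol : ∀ m, |1 - ∑ j, if m = g j then t j else 0| ≤ k * (2 * B * β) := fun m => by
    rw [← hN1 m, ← Finset.sum_sub_distrib]
    refine (Finset.abs_sum_le_sum_abs _ _).trans ?_
    simpa using Finset.sum_le_card_nsmul Finset.univ _ _ fun j _ => hent j m
  have hsurj : Function.Surjective g := fun m => by
    by_contra! hm
    have h1 := hcol m
    rw [Finset.sum_eq_zero fun j _ => if_neg (hm j).symm] at h1
    simp at h1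
    linarith
  have hbij : Function.Bijective g := Finite.surjective_iff_bijective.1 hsurj
  have ht1 : ∀ j, |t j - 1| ≤ k * (2 * B * β) := fun j => by
    have h1 := hcol (g j)
    rw [Finset.sum_eq_single j (fun i _ hi => if_neg fun h => hi (hbij.1 h.symm)) (by simp),
      if_pos rfl] at h1
    rwa [abs_sub_comm]
  refine ⟨Equiv.ofBijective g hbij, fun j f => ?_⟩
  have hperm : Equiv.Perm.permMatrix ℝ (Equiv.ofBijective g hbij) j f =
      if f = g j then 1 else 0 := by
    simp [Equiv.Perm.permMatrix, PEquiv.toMatrix_apply, Equiv.toPEquiv_apply, eq_comm]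
  rw [hperm]
  have h1 := hent j f
  have h2 := ht1 j
  split_ifs at h1 ⊢
  · have := abs_sub_le (N j f) (t j) 1
    linarith
  · linarith [mul_nonneg (by positivity : (0 : ℝ) ≤ k * B) hβ0]

/-! ### Concentration of the sample -/

lemma sum_likelihood_mul_exp {n V : ℕ} (u g : Fin V → ℝ) (t : ℝ) :
    ∑ x : Fin n → Fin V, likelihood x u * Real.exp (t * ∑ j, g (x j)) =
      (∑ a, u a * Real.exp (t * g a)) ^ n := by
  rw [Fintype.sum_pow]
  refine Finset.sum_congr rfl fun x _ => ?_
  rw [Finset.prod_mul_distrib, ← Real.exp_sum, Finset.mul_sum]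
  rfl

lemma sum_likelihood {n V : ℕ} {u : Fin V → ℝ} (hu : ∑ a, u a = 1) :
    ∑ x : Fin n → Fin V, likelihood x u = 1 := by
  simpa [hu] using sum_likelihood_mul_exp (n := n) u 0 0

open Classical in
/-- Chernoff's bound for the sum of a bounded centred statistic over the words of a document. -/
lemma sum_likelihood_tail_le {n V : ℕ} {u g : Fin V → ℝ} (hu : ∀ a, 0 ≤ u a) (hu1 : ∑ a, u a = 1)
    (hg : ∀ a, |g a| ≤ 1) (hug : ∑ a, u a * g a = 0) {ε : ℝ} (hε : 0 ≤ ε) (hε2 : ε ≤ 2) :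
    ∑ x : Fin n → Fin V, (if n * ε ≤ ∑ j, g (x j) then likelihood x u else 0) ≤
      Real.exp (-(n * ε ^ 2 / 4)) := by
  set t := ε / 2
  have ht0 : 0 ≤ t := by positivity
  have ht1 : t ≤ 1 := by simp only [t]; linarith
  have hmgf : ∑ a, u a * Real.exp (t * g a) ≤ Real.exp (t ^ 2) := by
    have h1 : ∀ a, u a * Real.exp (t * g a) ≤ u a + t * (u a * g a) + t ^ 2 * u a := fun a => by
      have h2 : |t * g a| ≤ 1 := by
        rw [abs_mul, abs_of_nonneg ht0]
        exact mul_le_one₀ ht1 (abs_nonneg _) (hg a)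
      have h3 := (abs_le.1 (Real.abs_exp_sub_one_sub_id_le h2)).2
      have h4 : g a ^ 2 ≤ 1 := by rw [sq_le_one_iff_abs_le_one]; exact hg a
      have h5 : (t * g a) ^ 2 ≤ t ^ 2 := by
        rw [mul_pow]; exact mul_le_of_le_one_right (sq_nonneg _) h4
      have h6 : Real.exp (t * g a) ≤ 1 + t * g a + t ^ 2 := by linarith
      have := mul_le_mul_of_nonneg_left h6 (hu a)
      linarith
    have h7 := Finset.sum_le_sum fun a (_ : a ∈ Finset.univ) => h1 a
    rw [Finset.sum_add_distrib, Finset.sum_add_distrib, ← Finset.mul_sum, ← Finset.mul_sum, hug,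
      hu1] at h7
    linarith [Real.add_one_le_exp (t ^ 2)]
  calc ∑ x : Fin n → Fin V, (if n * ε ≤ ∑ j, g (x j) then likelihood x u else 0)
      ≤ ∑ x : Fin n → Fin V, Real.exp (-(t * (n * ε))) *
          (likelihood x u * Real.exp (t * ∑ j, g (x j))) := by
        refine Finset.sum_le_sum fun x _ => ?_
        have hL := likelihood_nonneg x hu
        split_ifs with h
        · rw [mul_left_comm, ← Real.exp_add]
          refine le_mul_of_one_le_right hL (Real.one_le_exp ?_)
          have := mul_le_mul_of_nonneg_left h ht0
          linarith
        · positivity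
    _ ≤ Real.exp (-(t * (n * ε))) * Real.exp (t ^ 2) ^ n := by
        rw [← Finset.mul_sum, sum_likelihood_mul_exp]
        have : 0 ≤ ∑ a, u a * Real.exp (t * g a) :=
          Finset.sum_nonneg fun a _ => mul_nonneg (hu a) (Real.exp_pos _).le
        gcongr
    _ = Real.exp (-(n * ε ^ 2 / 4)) := by
        rw [← Real.exp_nat_mul, ← Real.exp_add]
        congr 1
        simp only [t]
        ring

open Classical in
lemma documentLaw_apply {V k n : ℕ} {C : Matrix (Fin V) (Fin k) ℝ} (hC : IsColumnStochastic C)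
    {P : Measure (EuclideanSpace ℝ (Fin k))} (hP : P (simplex k)ᶜ = 0)
    {A : Set (EuclideanSpace ℝ (Fin k) × (Fin n → Fin V))} (hA : MeasurableSet A) :
    documentLaw C P n A = ∫⁻ w, ENNReal.ofReal
      (∑ x : Fin n → Fin V, if (w, x) ∈ A then likelihood x (C *ᵥ w.ofLp) else 0) ∂P := by
  have hm : ∀ x : Fin n → Fin V, Measurable fun w : EuclideanSpace ℝ (Fin k) => (w, x) :=
    fun x => measurable_id.prodMk measurable_const
  have hL : ∀ x : Fin n → Fin V, Measurable fun w : EuclideanSpace ℝ (Fin k) =>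
      ENNReal.ofReal (likelihood x (C *ᵥ w.ofLp)) := fun x =>
    (continuous_likelihood_mulVec x C).measurable.ennreal_ofReal
  have hae : ∀ᵐ w ∂P, w ∈ simplex k := hP
  rw [documentLaw, Measure.finsetSum_apply]
  have h1 : ∀ x : Fin n → Fin V,
      ((P.withDensity fun w => ENNReal.ofReal (likelihood x (C *ᵥ w.ofLp))).map fun w => (w, x)) A =
      ∫⁻ w, ({w | (w, x) ∈ A}.indicator
        fun w => ENNReal.ofReal (likelihood x (C *ᵥ w.ofLp))) w ∂P := fun x => by
    rw [Measure.map_apply (hm x) hA, withDensity_apply _ (hm x hA),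
      ← lintegral_indicator (hm x hA)]
    rfl
  simp_rw [h1]
  rw [← lintegral_finsetSum]
  · refine lintegral_congr_ae ?_
    filter_upwards [hae] with w hw
    have hLw : ∀ x : Fin n → Fin V, 0 ≤ likelihood x (C *ᵥ w.ofLp) := fun x =>
      likelihood_nonneg x (mulVec_nonneg hC.1 hw.1)
    rw [ENNReal.ofReal_sum_of_nonneg]
    · refine Finset.sum_congr rfl fun x _ => ?_
      by_cases h : (w, x) ∈ A <;> simp [h]
    · intro x _
      split_ifs
      · exact hLw x
      · exact le_rfl
  · intro x _
    exact (hL x).indicator (hm x hA)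

/-- The weight of a document has law `P`. -/
lemma documentLaw_fst {V k n : ℕ} {C : Matrix (Fin V) (Fin k) ℝ} (hC : IsColumnStochastic C)
    {P : Measure (EuclideanSpace ℝ (Fin k))} (hP : P (simplex k)ᶜ = 0)
    {B : Set (EuclideanSpace ℝ (Fin k))} (hB : MeasurableSet B) :
    documentLaw C P n (Prod.fst ⁻¹' B) = P B := by
  classical
  have hae : ∀ᵐ w ∂P, w ∈ simplex k := hP
  rw [documentLaw_apply hC hP (measurable_fst hB), ← lintegral_indicator_one hB]
  refine lintegral_congr_ae ?_
  filter_upwards [hae] with w hw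
  by_cases h : w ∈ B
  · simp [h, sum_likelihood ((sum_mulVec_of_colSum hC.2 _).trans hw.2)]
  · simp [h]

lemma isProbabilityMeasure_documentLaw {V k n : ℕ} {C : Matrix (Fin V) (Fin k) ℝ}
    (hC : IsColumnStochastic C) {P : Measure (EuclideanSpace ℝ (Fin k))} [IsProbabilityMeasure P]
    (hP : P (simplex k)ᶜ = 0) : IsProbabilityMeasure (documentLaw C P n) :=
  ⟨by simpa using documentLaw_fst (n := n) hC hP MeasurableSet.univ⟩

lemma measurable_centredFreq {V k n : ℕ} (C : Matrix (Fin V) (Fin k) ℝ) (v : Fin V) :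
    Measurable fun z : EuclideanSpace ℝ (Fin k) × (Fin n → Fin V) =>
      wordFreq z.2 v - (C *ᵥ z.1.ofLp) v := by
  refine Measurable.sub ?_ ?_
  · exact (Measurable.of_discrete (f := fun x : Fin n → Fin V => wordFreq x v)).comp measurable_snd
  · have : Continuous fun w : EuclideanSpace ℝ (Fin k) => (C *ᵥ w.ofLp) v := by
      unfold Matrix.mulVec dotProduct
      fun_prop
    exact this.measurable.comp measurable_fst

/-- One-sided deviation bound for a word frequency; the sign `κ` selects the side. -/
lemma documentLaw_freq_le {V k n : ℕ} (hn : 1 ≤ n) {C : Matrix (Fin V) (Fin k) ℝ}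
    (hC : IsColumnStochastic C) {P : Measure (EuclideanSpace ℝ (Fin k))} [IsProbabilityMeasure P]
    (hP : P (simplex k)ᶜ = 0) (v : Fin V) {ε κ : ℝ} (hε : 0 ≤ ε) (hε2 : ε ≤ 2) (hκ : |κ| = 1) :
    documentLaw C P n {z | ε ≤ κ * (wordFreq z.2 v - (C *ᵥ z.1.ofLp) v)} ≤
      ENNReal.ofReal (Real.exp (-(n * ε ^ 2 / 4))) := by
  classical
  have hae : ∀ᵐ w ∂P, w ∈ simplex k := hP
  rw [documentLaw_apply hC hP
    (measurableSet_le measurable_const ((measurable_centredFreq C v).const_mul κ))]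
  calc _ ≤ ∫⁻ _w, ENNReal.ofReal (Real.exp (-(n * ε ^ 2 / 4))) ∂P := by
        refine lintegral_mono_ae ?_
        filter_upwards [hae] with w hw
        refine ENNReal.ofReal_le_ofReal ?_
        set u := C *ᵥ w.ofLp
        have hu0 : ∀ a, 0 ≤ u a := mulVec_nonneg hC.1 hw.1
        have hu1 : ∑ a, u a = 1 := (sum_mulVec_of_colSum hC.2 _).trans hw.2
        set g : Fin V → ℝ := fun a => κ * ((if a = v then 1 else 0) - u v)
        have huv : u v ≤ 1 := hu1 ▸ Finset.single_le_sum (fun b _ => hu0 b) (Finset.mem_univ v)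
        have hg : ∀ a, |g a| ≤ 1 := fun a => by
          simp only [g]
          rw [abs_mul, hκ, one_mul, abs_le]
          have := hu0 v
          split_ifs <;> constructor <;> linarith
        have hug : ∑ a, u a * g a = 0 := by
          simp only [g, mul_left_comm _ κ, mul_sub, Finset.sum_sub_distrib, ← Finset.mul_sum,
            ← Finset.sum_mul, hu1]
          simp
        refine le_trans (le_of_eq ?_) (sum_likelihood_tail_le (n := n) hu0 hu1 hg hug hε hε2)
        refine Finset.sum_congr rfl fun x _ => ?_
        have hsum : ∑ j, g (x j) = n * (κ * (wordFreq x v - u v)) := by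
          have hn0 : (n : ℝ) ≠ 0 := by positivity
          simp only [g, ← Finset.mul_sum, Finset.sum_sub_distrib, wordFreq]
          simp
          field_simp
        have hiff : (n * ε ≤ ∑ j, g (x j)) ↔ ε ≤ κ * (wordFreq x v - u v) := by
          rw [hsum, mul_le_mul_iff_right₀ (by positivity)]
        simp only [hiff]
        rfl
    _ = _ := by simp

/-- With high probability all weights lie in the simplex, all word frequencies are within `ε` of
the word probabilities, and every one of the points `p j` has a sampled weight within `r`. -/
lemma sampleLaw_real_ge {V k n d s : ℕ} (hn : 1 ≤ n) {C : Matrix (Fin V) (Fin k) ℝ}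
    (hC : IsColumnStochastic C) {P : Measure (EuclideanSpace ℝ (Fin k))} [IsProbabilityMeasure P]
    (hP : P (simplex k)ᶜ = 0) {ε r m : ℝ} (hε : 0 ≤ ε) (hε2 : ε ≤ 2)
    {p : Fin s → EuclideanSpace ℝ (Fin k)}
    (hp : ∀ j, ENNReal.ofReal m ≤ P (Metric.closedBall (p j) r))
    {A : Set (Fin d → EuclideanSpace ℝ (Fin k) × (Fin n → Fin V))}
    (hA : ∀ z : Fin d → EuclideanSpace ℝ (Fin k) × (Fin n → Fin V), (∀ i, (z i).1 ∈ simplex k) →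
      (∀ i v, |wordFreq (z i).2 v - (C *ᵥ (z i).1.ofLp) v| ≤ ε) →
      (∀ j, ∃ i, dist (z i).1 (p j) ≤ r) → z ∈ A) :
    1 - s * Real.exp (-(d * m)) - 2 * V * d * Real.exp (-(n * ε ^ 2 / 4)) ≤
      (sampleLaw C P n d).real A := by
  have hprob : IsProbabilityMeasure (documentLaw C P n) := isProbabilityMeasure_documentLaw hC hP
  have hprobS : IsProbabilityMeasure (sampleLaw C P n d) := by
    unfold sampleLaw; infer_instance
  set μ := sampleLaw C P n d
  set F : ℝ → Fin V → Set (EuclideanSpace ℝ (Fin k) × (Fin n → Fin V)) :=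
    fun κ v => {z | ε ≤ κ * (wordFreq z.2 v - (C *ᵥ z.1.ofLp) v)}
  have hF : ∀ κ v, MeasurableSet (F κ v) := fun κ v =>
    measurableSet_le measurable_const ((measurable_centredFreq C v).const_mul κ)
  have hcyl : ∀ (i : Fin d) (S : Set (EuclideanSpace ℝ (Fin k) × (Fin n → Fin V))),
      MeasurableSet S → μ (Function.eval i ⁻¹' S) = documentLaw C P n S := fun i S hS =>
    (measurePreserving_eval (fun _ : Fin d => documentLaw C P n) i).measure_preimage
      hS.nullMeasurableSet
  set e := ENNReal.ofReal (Real.exp (-(n * ε ^ 2 / 4)))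
  set q := ENNReal.ofReal (Real.exp (-(d * m)))
  have h0 : μ (⋃ i : Fin d, Function.eval i ⁻¹' (Prod.fst ⁻¹' (simplex k)ᶜ)) = 0 := by
    rw [measure_iUnion_null_iff]
    intro i
    rw [hcyl i _ (measurable_fst (measurableSet_simplex k).compl),
      documentLaw_fst hC hP (measurableSet_simplex k).compl, hP]
  have h1 : μ (⋃ i : Fin d, ⋃ v : Fin V, Function.eval i ⁻¹' (F 1 v ∪ F (-1) v)) ≤
      d * (V * (2 * e)) := by
    refine (measure_iUnion_fintype_le _ _).trans ?_
    calc _ ≤ ∑ _i : Fin d, (V * (2 * e)) := by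
          refine Finset.sum_le_sum fun i _ => (measure_iUnion_fintype_le _ _).trans ?_
          calc _ ≤ ∑ _v : Fin V, 2 * e := by
                refine Finset.sum_le_sum fun v _ => ?_
                rw [hcyl i _ ((hF _ _).union (hF _ _)), two_mul]
                exact (measure_union_le _ _).trans (add_le_add
                  (documentLaw_freq_le hn hC hP v hε hε2 (by simp))
                  (documentLaw_freq_le hn hC hP v hε hε2 (by simp)))
            _ = _ := by simp
      _ = _ := by simp
  have h2 : μ (⋃ j : Fin s, Set.univ.pi fun _ : Fin d =>
      (Prod.fst ⁻¹' (Metric.closedBall (p j) r)ᶜ :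
        Set (EuclideanSpace ℝ (Fin k) × (Fin n → Fin V)))) ≤ s * q := by
    refine (measure_iUnion_fintype_le _ _).trans ?_
    calc _ ≤ ∑ _j : Fin s, q := by
          refine Finset.sum_le_sum fun j _ => ?_
          change Measure.pi _ _ ≤ _
          rw [Measure.pi_pi]
          have hmb : MeasurableSet (Metric.closedBall (p j) r) :=
            Metric.isClosed_closedBall.measurableSet
          have h3 : P (Metric.closedBall (p j) r)ᶜ ≤ ENNReal.ofReal (Real.exp (-m)) := by
            rw [prob_compl_eq_one_sub hmb]
            calc 1 - P (Metric.closedBall (p j) r) ≤ 1 - ENNReal.ofReal m :=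
                  tsub_le_tsub_left (hp j) _
              _ ≤ ENNReal.ofReal (1 - m) := by
                  rw [← ENNReal.ofReal_one]
                  rcases le_total 0 m with h | h
                  · rw [ENNReal.ofReal_sub _ h]
                  · rw [ENNReal.ofReal_of_nonpos h, tsub_zero]
                    exact ENNReal.ofReal_le_ofReal (by linarith)
              _ ≤ _ := ENNReal.ofReal_le_ofReal (by linarith [Real.add_one_le_exp (-m)])
          simp only [documentLaw_fst hC hP hmb.compl, Finset.prod_const, Finset.card_univ,
            Fintype.card_fin]
          calc _ ≤ ENNReal.ofReal (Real.exp (-m)) ^ d := by gcongr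
            _ = q := by
                rw [← ENNReal.ofReal_pow (Real.exp_pos _).le, ← Real.exp_nat_mul]
                congr 2
                ring
      _ = _ := by simp
  have hcover : Aᶜ ⊆ (⋃ i : Fin d, Function.eval i ⁻¹' (Prod.fst ⁻¹' (simplex k)ᶜ)) ∪
      ((⋃ i : Fin d, ⋃ v : Fin V, Function.eval i ⁻¹' (F 1 v ∪ F (-1) v)) ∪
      (⋃ j : Fin s, Set.univ.pi fun _ : Fin d =>
        (Prod.fst ⁻¹' (Metric.closedBall (p j) r)ᶜ :
          Set (EuclideanSpace ℝ (Fin k) × (Fin n → Fin V))))) := by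
    intro z hz
    by_contra hcon
    simp only [Set.mem_union, Set.mem_iUnion, Set.mem_preimage, Set.mem_pi, Set.mem_compl_iff,
      not_or, not_exists, not_not, not_forall, Function.eval] at hcon
    obtain ⟨hc0, hc1, hc2⟩ := hcon
    refine hz (hA z hc0 (fun i v => ?_) fun j => ?_)
    · obtain ⟨ha, hb⟩ := hc1 i v
      have ha' : ¬ ε ≤ 1 * (wordFreq (z i).2 v - (C *ᵥ (z i).1.ofLp) v) := ha
      have hb' : ¬ ε ≤ -1 * (wordFreq (z i).2 v - (C *ᵥ (z i).1.ofLp) v) := hb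
      rw [abs_le]
      constructor <;> linarith
    · obtain ⟨i, -, hi⟩ := hc2 j
      exact ⟨i, hi⟩
  have h4 : μ Aᶜ ≤ ENNReal.ofReal
      (s * Real.exp (-(d * m)) + 2 * V * d * Real.exp (-(n * ε ^ 2 / 4))) := by
    refine (measure_mono hcover).trans ((measure_union_le _ _).trans ?_)
    rw [h0, zero_add]
    refine (measure_union_le _ _).trans ((add_le_add h1 h2).trans_eq ?_)
    rw [ENNReal.ofReal_add (by positivity) (by positivity), ENNReal.ofReal_mul (by positivity),
      ENNReal.ofReal_mul (by positivity), ENNReal.ofReal_mul (by positivity),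
      ENNReal.ofReal_mul (by positivity)]
    simp only [ENNReal.ofReal_natCast, ENNReal.ofReal_ofNat]
    ring
  have h5 : 1 ≤ μ.real A + μ.real Aᶜ := by
    have := measureReal_union_le (μ := μ) A Aᶜ
    rwa [Set.union_compl_self, probReal_univ] at this
  have h6 : μ.real Aᶜ ≤ s * Real.exp (-(d * m)) + 2 * V * d * Real.exp (-(n * ε ^ 2 / 4)) :=
    ENNReal.toReal_le_of_le_ofReal (by positivity) h4
  linarith

/-! ### The transition matrix of a maximizer -/

lemma exists_sum_sq_le_mulVec {V k : ℕ} {C : Matrix (Fin V) (Fin k) ℝ} (hC : C.rank = k) :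
    ∃ s₀ : ℝ, 0 < s₀ ∧ ∀ x : Fin k → ℝ, s₀ * ∑ f, x f ^ 2 ≤ ∑ a, (C *ᵥ x) a ^ 2 := by
  have hker : LinearMap.ker (Matrix.toEuclideanLin C) = ⊥ := by
    have h1 : LinearMap.ker C.mulVecLin = ⊥ := by
      have h := LinearMap.finrank_range_add_finrank_ker C.mulVecLin
      rw [← Matrix.rank, hC, Module.finrank_fin_fun] at h
      exact Submodule.finrank_eq_zero.1 (by omega)
    rw [LinearMap.ker_eq_bot'] at h1 ⊢
    intro x hx
    have h2 := h1 x.ofLp (congrArg WithLp.ofLp hx)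
    exact WithLp.ofLp_injective 2 h2
  obtain ⟨K, hK, hanti⟩ := LinearMap.exists_antilipschitzWith _ hker
  have hK0 : (0 : ℝ) < K := by exact_mod_cast hK
  refine ⟨1 / K ^ 2, by positivity, fun x => ?_⟩
  have h3 := hanti.le_mul_dist (WithLp.toLp 2 x) 0
  rw [map_zero, dist_zero_right, dist_zero_right] at h3
  have h4 := pow_le_pow_left₀ (norm_nonneg _) h3 2
  rw [mul_pow, EuclideanSpace.norm_sq_eq, EuclideanSpace.norm_sq_eq] at h4
  simp only [Real.norm_eq_abs, sq_abs] at h4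
  rw [div_mul_eq_mul_div, one_mul, div_le_iff₀ (by positivity), mul_comm]
  exact h4

lemma mul_le_of_le_div_add_one {A b ν : ℝ} (hA : 0 ≤ A) (hν : 0 ≤ ν) (h : ν ≤ b / (A + 1)) :
    A * ν ≤ b := by
  rw [le_div_iff₀ (by linarith)] at h
  linarith

lemma neg_le_of_sq_le {u B : ℝ} (hB : 0 ≤ B) (h : u ^ 2 ≤ B ^ 2) : -B ≤ u :=
  (abs_le.1 (abs_le_of_sq_le_sq h hB)).1

/-- On a sample whose word frequencies are within the noise level `ν` of their means, any maximizer
`Ĉ` of the integrated likelihood has a transition matrix `N` with `Ĉ N ≈ C₀`, with determinant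
nearly at least one, and that maps all the weights nearly into the positive orthant. -/
lemma exists_transition_of_isMLE {V k : ℕ} (hk : 1 ≤ k) {C₀ : Matrix (Fin V) (Fin k) ℝ}
    (hA1 : AssumptionA1 C₀) {l : ℝ} (hl : 0 < l) :
    ∃ K ν₀ : ℝ, 1 ≤ K ∧ 0 < ν₀ ∧ ∀ (n d : ℕ), 2 ≤ n → 1 ≤ d → ∀ ν : ℝ, 0 ≤ ν →
      ν ^ 2 = Real.log n / n → 1 / n ≤ ν → ν ≤ ν₀ →
      ∀ (X : Fin d → Fin n → Fin V) (C : Matrix (Fin V) (Fin k) ℝ), IsMLE X C →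
      ∀ w : Fin d → EuclideanSpace ℝ (Fin k), (∀ i, w i ∈ simplex k) →
      (∀ x : Fin k → ℝ, ∑ j, x j = 0 → l * (x ⬝ᵥ x) ≤ x ⬝ᵥ (((d : ℝ)⁻¹ •
        (centred (Matrix.of fun j i => w i j) * (centred (Matrix.of fun j i => w i j))ᵀ)) *ᵥ x)) →
      (∀ i v, |wordFreq (X i) v - (C₀ *ᵥ (w i).ofLp) v| ≤ 2 * ν) →
      ∃ N : Matrix (Fin k) (Fin k) ℝ, (∀ f, ∑ j, N j f = 1) ∧ (∀ j f, |N j f| ≤ K) ∧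
        (∀ a f, |(C * N) a f - C₀ a f| ≤ K * ν) ∧ 1 - K * ν ≤ |N.det| ∧
        ∀ i j, -(K * (√d * ν)) ≤ (N *ᵥ (w i).ofLp) j := by
  obtain ⟨hC₀, hrank, γ, hγ, hC₀γ⟩ := hA1
  obtain ⟨s₀, hs₀, hinj₀⟩ := exists_sum_sq_le_mulVec hrank
  have hk0 : (0 : ℝ) < k := by positivity
  set c : ℝ := min 1 l / (4 * k)
  have hc : 0 < c := div_pos (lt_min one_pos hl) (by positivity)
  set K₁ : ℝ := 16 * k + 64 * V / γ
  have hK₁ : 0 < K₁ := by positivity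
  set κ : ℝ := K₁ / c
  have hκ : 0 < κ := by positivity
  set s₁ : ℝ := s₀ / 4
  have hs₁ : 0 < s₁ := by positivity
  set K₃ : ℝ := 8 * V + 2 * (V * k * κ)
  have hK₃ : 0 ≤ K₃ := by positivity
  set K₄ : ℝ := √(8 * k ^ 2 * (2 * k + 1 + 4 * K₃ / γ) / s₁)
  have hK₄ : 0 ≤ K₄ := Real.sqrt_nonneg _
  have hK₄sq : K₄ ^ 2 = 8 * k ^ 2 * (2 * k + 1 + 4 * K₃ / γ) / s₁ := Real.sq_sqrt (by positivity)
  set K₅ : ℝ := k * k * (1 / c) * (2 * (V * k * κ) + 2 * K₁) / s₁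
  have hK₅ : 0 ≤ K₅ := by positivity
  refine ⟨1 + √(1 / c) + √κ + k * K₄ + √K₅,
    min ((γ / 2) / (√κ + 1)) (min ((√s₀ / 2) / (√(V * k * κ) + 1)) ((γ / 2) / (K₄ + 1))),
    ?_, by positivity, ?_⟩
  · have := Real.sqrt_nonneg (1 / c)
    have := Real.sqrt_nonneg κ
    have := Real.sqrt_nonneg K₅
    have : 0 ≤ k * K₄ := by positivity
    linarith
  intro n d hn hd ν hν hν2 hnν hνν₀ X C hC w hw hcent hfreq
  have hd1 : (1 : ℝ) ≤ d := by exact_mod_cast hd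
  have hsm1 : √κ * ν ≤ γ / 2 := mul_le_of_le_div_add_one (Real.sqrt_nonneg _) hν
    (hνν₀.trans (min_le_left _ _))
  have hsm2 : √(V * k * κ) * ν ≤ √s₀ / 2 := mul_le_of_le_div_add_one (Real.sqrt_nonneg _) hν
    (hνν₀.trans ((min_le_right _ _).trans (min_le_left _ _)))
  have hsm3 : K₄ * ν ≤ γ / 2 := mul_le_of_le_div_add_one hK₄ hν
    (hνν₀.trans ((min_le_right _ _).trans (min_le_right _ _)))
  have hsm2' : V * k * κ * ν ^ 2 ≤ s₀ / 4 := by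
    have h := pow_le_pow_left₀ (by positivity) hsm2 2
    rw [mul_pow, div_pow, Real.sq_sqrt (by positivity), Real.sq_sqrt hs₀.le] at h
    linarith
  -- the mean square fit of the documents
  have hE : ∀ i, ∑ a, (wordFreq (X i) a - (C₀ *ᵥ (w i).ofLp) a) ^ 2 ≤ 4 * V * ν ^ 2 := fun i => by
    have h1 : ∀ a, (wordFreq (X i) a - (C₀ *ᵥ (w i).ofLp) a) ^ 2 ≤ (2 * ν) ^ 2 := fun a =>
      sq_le_sq' (abs_le.1 (hfreq i a)).1 (abs_le.1 (hfreq i a)).2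
    have h2 := Finset.sum_le_card_nsmul Finset.univ _ _ fun a _ => h1 a
    simp only [Finset.card_univ, Fintype.card_fin, nsmul_eq_mul] at h2
    linarith
  obtain ⟨h, hh, hfit⟩ := exists_fit hk hn hγ hC.1 hC₀ hC₀γ X (hC.2 C₀ hC₀) w hw hE
  have hS : 16 * k * (Real.log n / n) + 16 * (4 * V * ν ^ 2) / γ = K₁ * ν ^ 2 := by
    rw [← hν2]; simp only [K₁]; ring
  rw [hS] at hfit
  set W : Matrix (Fin k) (Fin d) ℝ := Matrix.of fun j i => w i j
  set H : Matrix (Fin k) (Fin d) ℝ := Matrix.of fun j i => h i j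
  obtain ⟨N, hN1, hNb, hCN⟩ := exists_transition_matrix (C := C) (C₀ := C₀) (W := W) (H := H) hd hc
    (fun i => (hw i).2)
    (sum_sq_ge_of_centred hk hd (fun j i => (hw i).1 j) (fun i => (hw i).2) hl hcent)
    (fun j i => (hh i).1 j) (fun i => (hh i).2) hfit
  have hCNκ : ∀ a f, ((C * N) a f - C₀ a f) ^ 2 ≤ κ * ν ^ 2 := fun a f => by
    refine (hCN a f).trans_eq ?_
    simp only [κ]; ring
  have hCNabs : ∀ a f, |(C * N) a f - C₀ a f| ≤ √κ * ν := fun a f => by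
    refine abs_le_of_sq_le_sq ?_ (by positivity)
    rw [mul_pow, Real.sq_sqrt hκ.le]
    exact hCNκ a f
  have hdiff : ∀ x : Fin k → ℝ, ∑ a, ((C * N - C₀) *ᵥ x) a ^ 2 ≤
      V * k * κ * ν ^ 2 * ∑ f, x f ^ 2 := fun x => by
    refine (sum_sq_mulVec_le (fun a f => hCNκ a f) x).trans_eq ?_
    ring
  have hdiffw : ∀ i, ∑ a, ((C * N - C₀) *ᵥ (w i).ofLp) a ^ 2 ≤ V * k * κ * ν ^ 2 := fun i =>
    (hdiff _).trans (mul_le_of_le_one_right (by positivity) (sum_sq_le_one (hw i).1 (hw i).2))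
  have hCNγ : ∀ a f, γ / 2 ≤ (C * N) a f := fun a f => by
    have := (abs_le.1 (hCNabs a f)).1
    have := hC₀γ a f
    linarith
  have hinj : ∀ x : Fin k → ℝ, s₁ * ∑ f, x f ^ 2 ≤ ∑ a, ((C * N) *ᵥ x) a ^ 2 := fun x => by
    have h1 := hinj₀ x
    have h2 := sum_add_sq_le Finset.univ (fun a => ((C * N) *ᵥ x) a)
      (fun a => -((C * N - C₀) *ᵥ x) a)
    have h3 : ∀ a, ((C * N) *ᵥ x) a + -((C * N - C₀) *ᵥ x) a = (C₀ *ᵥ x) a := fun a => by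
      rw [Matrix.sub_mulVec, Pi.sub_apply]; ring
    simp only [h3, neg_sq] at h2
    have h4 := (hdiff x).trans (mul_le_mul_of_nonneg_right hsm2'
      (Finset.sum_nonneg fun f _ => sq_nonneg (x f)))
    simp only [s₁]
    linarith
  have hdet : 1 - 1 / n - k * (K₄ * ν) ≤ |N.det| := by
    refine det_transition_ge (E := K₃ * ν ^ 2) hk hn hd (half_pos hγ) hs₁ X hC hN1 hCNγ hinj w hw
      (fun i => ?_) (by positivity) hsm3 ?_
    · have h2 := sum_add_sq_le Finset.univ
        (fun a => wordFreq (X i) a - (C₀ *ᵥ (w i).ofLp) a)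
        (fun a => -((C * N - C₀) *ᵥ (w i).ofLp) a)
      have h3 : ∀ a, wordFreq (X i) a - (C₀ *ᵥ (w i).ofLp) a +
          -((C * N - C₀) *ᵥ (w i).ofLp) a =
          wordFreq (X i) a - ((C * N) *ᵥ (w i).ofLp) a := fun a => by
        rw [Matrix.sub_mulVec, Pi.sub_apply]; ring
      simp only [h3, neg_sq] at h2
      have := hE i
      have := hdiffw i
      simp only [K₃]
      linarith
    · rw [← hν2, div_pow, mul_pow, hK₄sq]
      refine le_of_eq ?_
      field_simp
      ring
  refine ⟨N, hN1, fun j f => ?_, fun a f => ?_, ?_, fun i j => ?_⟩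
  all_goals
    have hr1 := Real.sqrt_nonneg (1 / c)
    have hr2 := Real.sqrt_nonneg κ
    have hr3 := Real.sqrt_nonneg K₅
    have hr4 : 0 ≤ k * K₄ := by positivity
  · have h1 : |N j f| ≤ √(1 / c) := Real.abs_le_sqrt (hNb j f)
    linarith
  · refine (hCNabs a f).trans (mul_le_mul_of_nonneg_right ?_ hν)
    linarith
  · have : (1 + k * K₄) * ν ≤ (1 + √(1 / c) + √κ + k * K₄ + √K₅) * ν :=
      mul_le_mul_of_nonneg_right (by linarith) hν
    linarith
  · -- `Ĉ` is injective, and maps `N wᵢ` close to `C₀ wᵢ`, hence close to `Ĉ hᵢ`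
    set u : Fin k → ℝ := N *ᵥ (w i).ofLp - (h i).ofLp
    have h1 := mul_sum_sq_le_of_mul hs₁ hNb hinj u
    have h2 : ∑ a, (C *ᵥ u) a ^ 2 ≤ (2 * (V * k * κ) + 2 * K₁) * (d * ν ^ 2) := by
      have h3 := sum_add_sq_le Finset.univ (fun a => ((C * N - C₀) *ᵥ (w i).ofLp) a)
        (fun a => -((C *ᵥ (h i).ofLp) a - (C₀ *ᵥ (w i).ofLp) a))
      have h4 : ∀ a, ((C * N - C₀) *ᵥ (w i).ofLp) a +
          -((C *ᵥ (h i).ofLp) a - (C₀ *ᵥ (w i).ofLp) a) = (C *ᵥ u) a := fun a => by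
        simp only [u, Matrix.mulVec_sub, Matrix.sub_mulVec, Pi.sub_apply, Matrix.mulVec_mulVec]
        ring
      simp only [h4, neg_sq] at h3
      have h5 : ∑ a, ((C *ᵥ (h i).ofLp) a - (C₀ *ᵥ (w i).ofLp) a) ^ 2 ≤ d * (K₁ * ν ^ 2) :=
        (Finset.single_le_sum
          (f := fun i => ∑ a, ((C *ᵥ (h i).ofLp) a - (C₀ *ᵥ (w i).ofLp) a) ^ 2)
          (fun _ _ => Finset.sum_nonneg fun _ _ => sq_nonneg _) (Finset.mem_univ i)).trans hfit
      have h6 : V * k * κ * ν ^ 2 ≤ d * (V * k * κ * ν ^ 2) :=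
        le_mul_of_one_le_left (by positivity) hd1
      have := hdiffw i
      linarith
    have h7 : u j ^ 2 ≤ K₅ * (d * ν ^ 2) := by
      have h8 : s₁ * u j ^ 2 ≤ s₁ * ∑ j, u j ^ 2 :=
        mul_le_mul_of_nonneg_left (Finset.single_le_sum (f := fun j => u j ^ 2)
          (fun _ _ => sq_nonneg _) (Finset.mem_univ j)) hs₁.le
      have h9 := mul_le_mul_of_nonneg_left h2 (by positivity : 0 ≤ (k : ℝ) * k * (1 / c))
      have h10 : s₁ * u j ^ 2 ≤ s₁ * (K₅ * (d * ν ^ 2)) := by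
        refine (h8.trans (h1.trans h9)).trans_eq ?_
        simp only [K₅]
        field_simp
      exact le_of_mul_le_mul_left h10 hs₁
    have h11 : -(√K₅ * (√d * ν)) ≤ u j := by
      refine neg_le_of_sq_le (by positivity) ?_
      rw [mul_pow, mul_pow, Real.sq_sqrt hK₅, Real.sq_sqrt (by positivity)]
      exact h7
    have h12 : (N *ᵥ (w i).ofLp) j = u j + h i j := by simp [u]
    have h13 := (hh i).1 j
    have h14 : √K₅ * (√d * ν) ≤ (1 + √(1 / c) + √κ + k * K₄ + √K₅) * (√d * ν) :=
      mul_le_mul_of_nonneg_right (by linarith) (by positivity)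
    rw [h12]
    linarith

/-! ### The distance between topic matrices -/

lemma spectralNorm_le {V k : ℕ} {A : Matrix (Fin V) (Fin k) ℝ} {M : ℝ} (hM : 0 ≤ M)
    (hA : ∀ a f, |A a f| ≤ M) : spectralNorm A ≤ V * k * M := by
  refine ContinuousLinearMap.opNorm_le_bound _ (by positivity) fun x => ?_
  have h1 := sum_sq_mulVec_le (S := M ^ 2) (fun a f => sq_le_sq' (abs_le.1 (hA a f)).1
    (abs_le.1 (hA a f)).2) x.ofLp
  refine (sq_le_sq₀ (norm_nonneg _) (by positivity)).1 ?_
  rw [mul_pow, EuclideanSpace.norm_sq_eq, EuclideanSpace.norm_sq_eq]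
  simp only [Real.norm_eq_abs, sq_abs]
  refine h1.trans (mul_le_mul_of_nonneg_right ?_ (Finset.sum_nonneg fun _ _ => sq_nonneg _))
  rw [mul_pow]
  refine mul_le_mul_of_nonneg_right ?_ (sq_nonneg _)
  exact_mod_cast Nat.le_self_pow two_ne_zero (V * k)

lemma dis_le {V k : ℕ} {C C' : Matrix (Fin V) (Fin k) ℝ} (π : Equiv.Perm (Fin k)) {M : ℝ}
    (hM : 0 ≤ M) (h : ∀ a f, |(C' - C * π.permMatrix ℝ) a f| ≤ M) : dis C C' ≤ V * k * M :=
  (ciInf_le (Set.finite_range _).bddBelow π).trans (spectralNorm_le hM h)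

lemma IsColumnStochastic.le_one {V k : ℕ} {C : Matrix (Fin V) (Fin k) ℝ}
    (hC : IsColumnStochastic C) (a : Fin V) (f : Fin k) : C a f ≤ 1 := by
  rw [← hC.2 f]
  exact Finset.single_le_sum (f := fun a => C a f) (fun b _ => hC.1 b f) (Finset.mem_univ a)

lemma dis_le_of_isColumnStochastic {V k : ℕ} {C C' : Matrix (Fin V) (Fin k) ℝ}
    (hC : IsColumnStochastic C) (hC' : IsColumnStochastic C') : dis C C' ≤ V * k := by
  have h := dis_le (C := C) (C' := C') 1 zero_le_one fun a f => by
    rw [Matrix.permMatrix_one, Matrix.mul_one, Matrix.sub_apply, abs_le]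
    have := hC.1 a f
    have := hC.le_one a f
    have := hC'.1 a f
    have := hC'.le_one a f
    constructor <;> linarith
  simpa using h

/-- If `C N` is close to `C'` and `N` is close to a permutation matrix, then `C` is close to `C'` up
to a permutation of the columns. -/
lemma dis_le_of_near_perm {V k : ℕ} {C C' : Matrix (Fin V) (Fin k) ℝ}
    (hC : IsColumnStochastic C) {N : Matrix (Fin k) (Fin k) ℝ} (π : Equiv.Perm (Fin k)) {M₁ M₂ : ℝ}
    (hM₁ : 0 ≤ M₁) (hM₂ : 0 ≤ M₂) (h₁ : ∀ a f, |(C * N) a f - C' a f| ≤ M₁)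
    (h₂ : ∀ j f, |N j f - π.permMatrix ℝ j f| ≤ M₂) : dis C C' ≤ V * k * (M₁ + k * M₂) := by
  refine dis_le π (by positivity) fun a f => ?_
  have h3 : (C' - C * π.permMatrix ℝ) a f =
      -((C * N) a f - C' a f) + ∑ j, C a j * (N j f - π.permMatrix ℝ j f) := by
    simp only [mul_sub, Finset.sum_sub_distrib, Matrix.sub_apply, Matrix.mul_apply]
    ring
  rw [h3]
  refine (abs_add_le _ _).trans (add_le_add ?_ ?_)
  · rw [abs_neg]; exact h₁ a f
  · refine (Finset.abs_sum_le_sum_abs _ _).trans ?_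
    have h4 : ∀ j, |C a j * (N j f - π.permMatrix ℝ j f)| ≤ M₂ := fun j => by
      rw [abs_mul, abs_of_nonneg (hC.1 a j)]
      exact (mul_le_of_le_one_left (abs_nonneg _) (hC.le_one a j)).trans (h₂ j f)
    simpa using Finset.sum_le_card_nsmul Finset.univ _ _ fun j _ => h4 j

/-! ### Rates -/

lemma tendsto_log_div_natCast :
    Filter.Tendsto (fun n : ℕ => Real.log n / n) Filter.atTop (nhds 0) :=
  (Real.isLittleO_log_id_atTop.tendsto_div_nhds_zero).comp tendsto_natCast_atTop_atTop

lemma eventually_noise_le {ε : ℝ} (hε : 0 < ε) :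
    ∀ᶠ n : ℕ in Filter.atTop, √(Real.log n / n) ≤ ε := by
  have h := (Real.continuous_sqrt.tendsto 0).comp tendsto_log_div_natCast
  rw [Real.sqrt_zero] at h
  exact h.eventually_le_const hε

lemma eventually_samplingRate_le {k : ℕ} (hk : 2 ≤ k) {ε : ℝ} (hε : 0 < ε) :
    ∀ᶠ d : ℕ in Filter.atTop, samplingRate k d ≤ ε := by
  have hk' : (0 : ℝ) < 1 / ((k : ℝ) - 1) := by
    have : (2 : ℝ) ≤ k := by exact_mod_cast hk
    exact one_div_pos.2 (by linarith)
  have h := tendsto_log_div_natCast.rpow_const (p := 1 / ((k : ℝ) - 1)) (Or.inr hk'.le)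
  rw [Real.zero_rpow hk'.ne'] at h
  exact h.eventually_le_const hε

lemma one_le_log_of_three_le {x : ℝ} (hx : 3 ≤ x) : 1 ≤ Real.log x := by
  rw [Real.le_log_iff_exp_le (by linarith)]
  linarith [Real.exp_one_lt_d9]

lemma samplingRate_pow {k d : ℕ} (hk : 2 ≤ k) (hd : 1 ≤ d) :
    samplingRate k d ^ (k - 1) = Real.log d / d := by
  have hd1 : (1 : ℝ) ≤ d := by exact_mod_cast hd
  have h := Real.rpow_inv_natCast_pow (x := Real.log d / d) (n := k - 1)
    (div_nonneg (Real.log_nonneg hd1) (by linarith)) (by omega)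
  rw [Nat.cast_sub (by omega), Nat.cast_one] at h
  rw [samplingRate, one_div, h]

lemma one_div_le_samplingRate {k d : ℕ} (hk : 2 ≤ k) (hd : 3 ≤ d) :
    1 / (d : ℝ) ≤ samplingRate k d := by
  have hd3 : (3 : ℝ) ≤ d := by exact_mod_cast hd
  have hd0 : (0 : ℝ) < d := by linarith
  have hk2 : (2 : ℝ) ≤ k := by exact_mod_cast hk
  have hlog := one_le_log_of_three_le hd3
  have h1 : 1 / (d : ℝ) ≤ Real.log d / d := by gcongr
  have h2 : Real.log d / d ≤ 1 := by
    rw [div_le_one hd0]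
    linarith [Real.log_le_sub_one_of_pos hd0]
  refine h1.trans ?_
  have h3 := Real.rpow_le_rpow_of_exponent_ge (x := Real.log d / d)
    (y := 1) (z := 1 / ((k : ℝ) - 1)) (by positivity) h2
    (by rw [div_le_one (by linarith)]; linarith)
  rwa [Real.rpow_one] at h3

/-- In the regime `d ^ 4 < n`, even a mean square error concentrated in a single document is of
order `1 / d`, hence at most of the order of the sampling rate. -/
lemma sqrt_mul_noise_le {n d : ℕ} (hd : 1 ≤ d) (hnd : d ^ 4 < n) :
    √d * √(Real.log n / n) ≤ 2 / d := by
  have hd0 : (0 : ℝ) < d := by positivity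
  have hn0 : (0 : ℝ) < n := by exact_mod_cast (Nat.zero_le _).trans_lt hnd
  rw [← Real.sqrt_mul hd0.le, Real.sqrt_le_left (by positivity)]
  set y : ℝ := (n : ℝ) ^ (1 / 4 : ℝ)
  have hy0 : 0 < y := by positivity
  have hy4 : y ^ 4 = n := by
    rw [← Real.rpow_natCast, ← Real.rpow_mul hn0.le]
    norm_num
  have hdy : (d : ℝ) ≤ y := by
    have h : (d : ℝ) ^ 4 ≤ y ^ 4 := by rw [hy4]; exact_mod_cast hnd.le
    exact le_of_pow_le_pow_left₀ (by norm_num) hy0.le h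
  have hlog : Real.log n ≤ 4 * y := by
    have := Real.log_le_rpow_div hn0.le (by norm_num : (0 : ℝ) < 1 / 4)
    linarith
  have h1 : (d : ℝ) ^ 3 * Real.log n ≤ 4 * n := by
    calc (d : ℝ) ^ 3 * Real.log n ≤ y ^ 3 * (4 * y) := by
          have := hdy
          gcongr
      _ = 4 * (n : ℝ) := by rw [← hy4]; ring
  rw [div_pow, mul_div_assoc', div_le_div_iff₀ hn0 (by positivity)]
  linarith

lemma one_div_le_noise {n : ℕ} (hn : 3 ≤ n) : 1 / (n : ℝ) ≤ √(Real.log n / n) := by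
  have hn3 : (3 : ℝ) ≤ n := by exact_mod_cast hn
  have hlog := one_le_log_of_three_le hn3
  apply Real.le_sqrt_of_sq_le
  rw [div_pow, one_pow, div_le_div_iff₀ (by positivity) (by positivity)]
  nlinarith [mul_le_mul_of_nonneg_right hlog (sq_nonneg (n : ℝ))]

lemma IsSS.pos {k s : ℕ} (hk : 1 ≤ k) {w : Fin s → EuclideanSpace ℝ (Fin k)} {α β : ℝ}
    (h : IsSS w α β) : 1 ≤ s := by
  by_contra! hs
  obtain rfl : s = 0 := by omega
  have hmem : -EuclideanSpace.single (⟨0, hk⟩ : Fin k) (1 : ℝ) ∈ dualCone (cone w) := by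
    rintro _ ⟨c, -, rfl⟩
    simp
  have h1 : ‖-EuclideanSpace.single (⟨0, hk⟩ : Fin k) (1 : ℝ)‖ ≤
    ∑ j, (-EuclideanSpace.single (⟨0, hk⟩ : Fin k) (1 : ℝ)) j := h.dualCone_subset hmem
  simp at h1
  linarith

/-! ### The error bound -/

/-- The deterministic part of the argument: on a sample with accurate word frequencies and with a
weight within `r` of each of the scattered points, the error of the maximizer is of the order of
`ν + β`. -/
lemma exists_dis_le {V k : ℕ} (hk : 2 ≤ k) {C₀ : Matrix (Fin V) (Fin k) ℝ}
    (hA1 : AssumptionA1 C₀) {l : ℝ} (hl : 0 < l) :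
    ∃ K ν₀ D₃ D₄ : ℝ, 1 ≤ K ∧ 0 < ν₀ ∧ 0 < D₃ ∧ 0 < D₄ ∧ ∀ (n d s : ℕ), 3 ≤ n → 1 ≤ d →
      √(Real.log n / n) ≤ ν₀ →
      ∀ (X : Fin d → Fin n → Fin V) (C : Matrix (Fin V) (Fin k) ℝ), IsMLE X C →
      ∀ w : Fin d → EuclideanSpace ℝ (Fin k), (∀ i, w i ∈ simplex k) →
      (∀ x : Fin k → ℝ, ∑ j, x j = 0 → l * (x ⬝ᵥ x) ≤ x ⬝ᵥ (((d : ℝ)⁻¹ •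
        (centred (Matrix.of fun j i => w i j) * (centred (Matrix.of fun j i => w i j))ᵀ)) *ᵥ x)) →
      (∀ i v, |wordFreq (X i) v - (C₀ *ᵥ (w i).ofLp) v| ≤ 2 * √(Real.log n / n)) →
      ∀ (p : Fin s → EuclideanSpace ℝ (Fin k)) (α β r : ℝ), (∀ j, p j ∈ simplex k) → IsSS p α β →
      0 ≤ r → (∀ j, ∃ i, dist (w i) (p j) ≤ r) →
      K * (√(Real.log n / n) + √d * √(Real.log n / n) + r) ≤ 1 / 2 →
      K * (√(Real.log n / n) + √d * √(Real.log n / n) + r) ≤ α / K →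
      dis C C₀ ≤ D₃ * √(Real.log n / n) + D₄ * β := by
  have hk1 : (1 : ℝ) ≤ k := by exact_mod_cast (by omega : 1 ≤ k)
  obtain ⟨K, ν₀, hK1, hν₀, hmain⟩ := exists_transition_of_isMLE (by omega) hA1 hl
  set B : ℝ := k * K
  have hB1 : 1 ≤ B := one_le_mul_of_one_le_of_one_le hk1 hK1
  have hKB : K ≤ B := le_mul_of_one_le_left (by linarith) hk1
  set M : ℝ := 8 * k ^ 2 * B ^ k
  have hBM : B ≤ M := by
    have h1 : B ≤ B ^ k := le_self_pow₀ hB1 (by omega)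
    have h2 : (1 : ℝ) ≤ 8 * k ^ 2 := by nlinarith
    exact h1.trans (le_mul_of_one_le_left (by positivity) h2)
  refine ⟨M, ν₀, V * k * K + 1, V * k * (k * (4 * k * B)) + 1, by linarith, hν₀, by positivity,
    by positivity, ?_⟩
  intro n d s hn hd hν X C hC w hw hcent hfreq p α β r hp hSS hr hcov hρ2 hρα
  set ν := √(Real.log n / n)
  have hν0 : 0 ≤ ν := Real.sqrt_nonneg _
  have hn1 : (1 : ℝ) ≤ n := by exact_mod_cast (by omega : 1 ≤ n)
  have hβ0 := hSS.beta_nonneg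
  by_cases hβ : β ≤ 1 / (4 * k * B)
  · obtain ⟨N, hN1, hNK, hCN, hdet, hNw⟩ := hmain n d (by omega) hd ν hν0
      (Real.sq_sqrt (div_nonneg (Real.log_nonneg hn1) (by linarith))) (one_div_le_noise hn) hν
      X C hC w hw hcent hfreq
    set ρ : ℝ := B * (ν + √d * ν + r)
    have hsum0 : 0 ≤ ν + √d * ν + r := by positivity
    have hρM : ρ ≤ M * (ν + √d * ν + r) := mul_le_mul_of_nonneg_right hBM hsum0
    have hNp : ∀ j f, -ρ ≤ (N *ᵥ (p j).ofLp) f := fun j f => by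
      obtain ⟨i, hi⟩ := hcov j
      have h1 := hNw i f
      have h2 : (N *ᵥ (p j).ofLp) f =
          (N *ᵥ (w i).ofLp) f - ∑ m, N f m * (w i - p j) m := by
        simp only [Matrix.mulVec, dotProduct, PiLp.sub_apply, mul_sub, Finset.sum_sub_distrib]
        ring
      have h3 : ∑ m, N f m * (w i - p j) m ≤ k * (K * r) := by
        have h4 : ∀ m, N f m * (w i - p j) m ≤ K * r := fun m => by
          refine (le_abs_self _).trans ?_
          rw [abs_mul]
          refine mul_le_mul (hNK f m) ?_ (abs_nonneg _) (by linarith)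
          refine le_trans (PiLp.norm_apply_le (w i - p j) m) ?_
          rwa [← dist_eq_norm]
        simpa using Finset.sum_le_card_nsmul Finset.univ _ _ fun m _ => h4 m
      have h5 : K * (√d * ν) ≤ B * (√d * ν) := mul_le_mul_of_nonneg_right hKB (by positivity)
      have h6 : 0 ≤ B * ν := by positivity
      have h7 : (k : ℝ) * (K * r) = B * r := by simp only [B]; ring
      rw [h2]
      simp only [ρ]
      linarith
    have hdetρ : 1 - ρ ≤ |N.det| := by
      have h1 : K * ν ≤ B * ν := mul_le_mul_of_nonneg_right hKB hν0
      have h2 : 0 ≤ B * (√d * ν + r) := by positivity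
      simp only [ρ]
      linarith
    have hαρ : M * ρ ≤ α := by
      rw [le_div_iff₀ (by linarith)] at hρα
      calc M * ρ ≤ M * (M * (ν + √d * ν + r)) := by gcongr
        _ ≤ α := by linarith
    obtain ⟨π, hπ⟩ := exists_perm_near (by omega) hK1 hp hSS hN1 hNK hNp hdetρ (by positivity)
      (by linarith) hαρ hβ
    have h := dis_le_of_near_perm hC.1 π (by positivity) (by positivity) hCN hπ
    refine h.trans ?_
    change V * k * (K * ν + k * (4 * k * B * β)) ≤ _
    linarith
  · -- for large `β` the trivial bound suffices
    have h1 := dis_le_of_isColumnStochastic hC.1 hA1.columnStochastic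
    have h2 : 1 ≤ 4 * k * B * β := by
      rw [not_le, div_lt_iff₀ (by positivity)] at hβ
      linarith
    have h3 : (V : ℝ) * k ≤ V * k * (k * (4 * k * B * β)) := by
      refine le_mul_of_one_le_right (by positivity) ?_
      exact one_le_mul_of_one_le_of_one_le hk1 h2
    have h4 : 0 ≤ (V * k * K + 1) * ν := by positivity
    linarith

end TopicModel

end

theorem mainTheorem4 (V k : ℕ) (hk : 2 ≤ k)
    (C₀ : Matrix (Fin V) (Fin k) ℝ) (hA1 : TopicModel.AssumptionA1 C₀)
    (l σ r₀ c₀ : ℝ) (hl : 0 < l) (hσ : 0 < σ) (hr₀ : 0 < r₀) (hc₀ : 0 < c₀) :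
    ∃ c C₁ D₁ D₂ D₃ D₄ : ℝ,
      0 < c ∧ 0 < C₁ ∧ 0 < D₁ ∧ 0 < D₂ ∧ 0 < D₃ ∧ 0 < D₄ ∧
      ∀ C₂ : ℝ, 0 < C₂ → ∃ D₃' D₄' : ℝ, 0 < D₃' ∧ 0 < D₄' ∧
      ∀ (s n d : ℕ), 1 ≤ n → 1 ≤ d →
      ∀ (P : MeasureTheory.Measure (EuclideanSpace ℝ (Fin k))) (α β : ℝ),
      TopicModel.IsSSDistribution P α β s r₀ c₀ →
      C₁ * (TopicModel.noiseRate n d + TopicModel.samplingRate k d) ≤ α →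
      ∀ Chat : (Fin d → Fin n → Fin V) → Matrix (Fin V) (Fin k) ℝ,
      (∀ X, TopicModel.IsMLE X (Chat X)) →
        (1 - D₁ * s / d - D₂ * d / ((max n d : ℕ) : ℝ) ^ c ≤
          (TopicModel.sampleLaw C₀ P n d).real
            {z | TopicModel.AssumptionA2 (TopicModel.weights z) l σ →
              TopicModel.dis (Chat (TopicModel.words z)) C₀ ≤
                D₃ * TopicModel.noiseRate n d + D₄ * β}) ∧
        (β ≤ C₂ * (TopicModel.noiseRate n d + TopicModel.samplingRate k d) →
          1 - D₁ * s / d - D₂ * d / ((max n d : ℕ) : ℝ) ^ c ≤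
            (TopicModel.sampleLaw C₀ P n d).real
              {z | TopicModel.AssumptionA2 (TopicModel.weights z) l σ →
                TopicModel.dis (Chat (TopicModel.words z)) C₀ ≤
                  D₃' * TopicModel.noiseRate n d + D₄' * TopicModel.samplingRate k d}) := by
  open TopicModel in
  obtain ⟨K, ν₀, D₃, D₄, hK1, hν₀, hD₃, hD₄, hmain⟩ := exists_dis_le hk hA1 hl
  -- a ball of radius `R * samplingRate` around a scattered point has mass at least `log d / d`
  set R : ℝ := max 1 (1 / c₀)
  have hR1 : 1 ≤ R := le_max_left _ _
  have hRc : 1 ≤ c₀ * R := by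
    have := mul_le_mul_of_nonneg_left (le_max_right 1 (1 / c₀)) hc₀.le
    rwa [mul_one_div_cancel hc₀.ne'] at this
  set ν₁ : ℝ := min ν₀ (min 1 (1 / (4 * K)))
  set S₁ : ℝ := min (r₀ / R) (1 / (4 * K * (2 + R)))
  obtain ⟨d₀, hd₀⟩ := Filter.eventually_atTop.1
    ((eventually_noise_le (ε := ν₁) (by positivity)).and
      (eventually_samplingRate_le hk (ε := S₁) (by positivity)))
  refine ⟨1 / 4, K * K * (3 + R), d₀ + 3, 2 * V + 1, D₃, D₄, by norm_num, by positivity,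
    by positivity, by positivity, hD₃, hD₄, ?_⟩
  intro C₂ hC₂
  refine ⟨D₃ + D₄ * C₂, D₄ * C₂, by positivity, by positivity, ?_⟩
  intro s n d hn hd P α β hP hα Chat hChat
  obtain ⟨hprob, hsimplex, p, -, hpsupp, hSS, hball⟩ := hP
  have hprobD : IsProbabilityMeasure (documentLaw C₀ P n) :=
    isProbabilityMeasure_documentLaw hA1.columnStochastic hsimplex
  have hprobS : IsProbabilityMeasure (sampleLaw C₀ P n d) := by
    unfold sampleLaw; infer_instance
  have hfirst : 1 - ((d₀ : ℝ) + 3) * s / d -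
      (2 * (V : ℝ) + 1) * d / ((max n d : ℕ) : ℝ) ^ (1 / 4 : ℝ) ≤
      (sampleLaw C₀ P n d).real {z | AssumptionA2 (weights z) l σ →
        dis (Chat (words z)) C₀ ≤ D₃ * noiseRate n d + D₄ * β} := by
    have hd0 : (0 : ℝ) < d := by exact_mod_cast hd
    have hs1 : (1 : ℝ) ≤ s := by exact_mod_cast hSS.pos (by omega)
    -- the claimed probability is positive only if `d` is large and `d ^ 4 < n`
    by_cases hd_large : ((d₀ : ℝ) + 3) * s < d
    swap
    · have h1 : 1 ≤ ((d₀ : ℝ) + 3) * s / d := by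
        rw [le_div_iff₀ hd0]; linarith
      have h2 : 0 ≤ (2 * (V : ℝ) + 1) * d / ((max n d : ℕ) : ℝ) ^ (1 / 4 : ℝ) := by positivity
      exact le_trans (by linarith) measureReal_nonneg
    by_cases hn_large : d ^ 4 < max n d
    swap
    · have h1 : 1 ≤ (2 * (V : ℝ) + 1) * d / ((max n d : ℕ) : ℝ) ^ (1 / 4 : ℝ) := by
        have hmax : (0 : ℝ) < (max n d : ℕ) := by
          exact_mod_cast (lt_of_lt_of_le hd (le_max_right n d) : 0 < max n d)
        rw [le_div_iff₀ (by positivity), one_mul]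
        have h2 : ((max n d : ℕ) : ℝ) ^ (1 / 4 : ℝ) ≤ d := by
          have h3 : ((max n d : ℕ) : ℝ) ≤ (d : ℝ) ^ (4 : ℕ) := by exact_mod_cast not_lt.1 hn_large
          calc ((max n d : ℕ) : ℝ) ^ (1 / 4 : ℝ) ≤ ((d : ℝ) ^ (4 : ℕ)) ^ (1 / 4 : ℝ) := by gcongr
            _ = d := by
                rw [← Real.rpow_natCast, ← Real.rpow_mul hd0.le]
                norm_num
        refine h2.trans (le_mul_of_one_le_left hd0.le ?_)
        have : (0 : ℝ) ≤ V := by positivity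
        linarith
      have h2 : 0 ≤ ((d₀ : ℝ) + 3) * s / d := by positivity
      exact le_trans (by linarith) measureReal_nonneg
    have hd_nat : d₀ + 3 < d := by
      have h1 : (d₀ : ℝ) + 3 < d := lt_of_le_of_lt
        (le_mul_of_one_le_right (by positivity) hs1) hd_large
      exact_mod_cast h1
    have hdpow : d ≤ d ^ 4 := Nat.le_self_pow (by norm_num) d
    have hmax : max n d = n := max_eq_left (by
      by_contra! h
      rw [max_eq_right h.le] at hn_large
      omega)
    rw [hmax] at hn_large ⊢
    have hdn : d < n := by omega
    have hn1 : (1 : ℝ) ≤ n := by exact_mod_cast hn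
    have hnoise : noiseRate n d = √(Real.log n / n) := by rw [noiseRate, hmax]
    rw [hnoise] at hα ⊢
    set ν := √(Real.log n / n)
    set S := samplingRate k d
    have hν : ν ≤ ν₁ := (hd₀ n (by omega)).1
    have hS : S ≤ S₁ := (hd₀ d (by omega)).2
    have hν0 : 0 ≤ ν := Real.sqrt_nonneg _
    have hν2 : ν ^ 2 = Real.log n / n :=
      Real.sq_sqrt (div_nonneg (Real.log_nonneg hn1) (by linarith))
    have hνK : K * ν ≤ 1 / 4 := by
      have h := hν.trans ((min_le_right _ _).trans (min_le_right _ _))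
      rw [le_div_iff₀ (by positivity)] at h
      linarith
    have hSd : 1 / (d : ℝ) ≤ S := one_div_le_samplingRate hk (by omega)
    have hS0 : 0 < S := lt_of_lt_of_le (by positivity) hSd
    have hSK : K * ((2 + R) * S) ≤ 1 / 4 := by
      have h := hS.trans (min_le_right _ _)
      rw [le_div_iff₀ (by positivity)] at h
      linarith
    have hRS : R * S ≤ r₀ := by
      have h := hS.trans (min_le_left _ _)
      rw [le_div_iff₀ (by positivity)] at h
      linarith
    have hdν : √d * ν ≤ 2 * S := by
      refine (sqrt_mul_noise_le hd hn_large).trans ?_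
      rw [← mul_one_div]
      linarith
    have hsum : ν + √d * ν + R * S ≤ ν + (2 + R) * S := by linarith
    have hpΔ : ∀ j, p j ∈ simplex k := fun j =>
      Measure.support_subset_of_isClosed (isCompact_simplex k).isClosed hsimplex (hpsupp j)
    have hmass : 1 * Real.log d ≤ d * ((k - 1).factorial * c₀ * (R * S) ^ (k - 1)) := by
      rw [mul_pow, samplingRate_pow hk hd]
      have h1 : (1 : ℝ) ≤ (k - 1).factorial := by
        exact_mod_cast Nat.one_le_of_lt (Nat.factorial_pos _)
      have h2 : c₀ * R ≤ c₀ * R ^ (k - 1) :=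
        mul_le_mul_of_nonneg_left (le_self_pow₀ hR1 (by omega)) hc₀.le
      have h3 : 1 ≤ (k - 1).factorial * (c₀ * R ^ (k - 1)) :=
        one_le_mul_of_one_le_of_one_le h1 (hRc.trans h2)
      have h4 : 0 ≤ Real.log d := Real.log_nonneg (by exact_mod_cast hd)
      refine (mul_le_mul_of_nonneg_right h3 h4).trans_eq ?_
      field_simp
    have hbound := sampleLaw_real_ge (d := d) hn hA1.columnStochastic hsimplex (ε := 2 * ν)
      (r := R * S) (by positivity)
      (by linarith [hν.trans ((min_le_right _ _).trans (min_le_left _ _))])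
      (fun j => hball j (R * S) (by positivity) hRS)
      (A := {z | AssumptionA2 (weights z) l σ → dis (Chat (words z)) C₀ ≤ D₃ * ν + D₄ * β})
      (fun z hzΔ hzf hzp hA2 => by
        refine hmain n d s (by omega) hd (hν.trans (min_le_left _ _)) (words z) _ (hChat _)
          (fun i => (z i).1) hzΔ hA2.eigenvalues_ge hzf p α β (R * S) hpΔ hSS (by positivity) hzp
          ?_ ?_
        · have := mul_le_mul_of_nonneg_left hsum (by linarith : 0 ≤ K)
          linarith
        · rw [le_div_iff₀ (by linarith)]
          refine le_trans ?_ hα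
          have h1 : ν + (2 + R) * S ≤ (3 + R) * (ν + S) := by
            have : 0 ≤ (2 + R) * ν := by positivity
            linarith
          have := mul_le_mul_of_nonneg_left (hsum.trans h1) (by positivity : 0 ≤ K * K)
          linarith)
    refine le_trans ?_ hbound
    have hfail1 : s * Real.exp (-(d * ((k - 1).factorial * c₀ * (R * S) ^ (k - 1)))) ≤
        ((d₀ : ℝ) + 3) * s / d := by
      have h1 : Real.exp (-(d * ((k - 1).factorial * c₀ * (R * S) ^ (k - 1)))) ≤ 1 / d := by
        rw [one_div, ← Real.exp_log hd0, ← Real.exp_neg, Real.exp_log hd0]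
        exact Real.exp_le_exp.2 (by linarith)
      calc _ ≤ s * (1 / (d : ℝ)) := by gcongr
        _ ≤ ((d₀ : ℝ) + 3) * (s * (1 / d)) :=
            le_mul_of_one_le_left (by positivity) (by linarith [Nat.cast_nonneg (α := ℝ) d₀])
        _ = _ := by ring
    have hfail2 : 2 * V * d * Real.exp (-(n * (2 * ν) ^ 2 / 4)) ≤
        (2 * (V : ℝ) + 1) * d / (n : ℝ) ^ (1 / 4 : ℝ) := by
      have hn0 : (0 : ℝ) < n := by linarith
      have h1 : (n : ℝ) * (2 * ν) ^ 2 / 4 = Real.log n := by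
        rw [mul_pow, hν2]; field_simp; ring
      rw [h1, Real.exp_neg, Real.exp_log hn0, div_eq_mul_inv]
      have h2 : (n : ℝ) ^ (1 / 4 : ℝ) ≤ n := by
        simpa using Real.rpow_le_rpow_of_exponent_le hn1 (by norm_num : (1 / 4 : ℝ) ≤ 1)
      have h3 : 0 < (n : ℝ) ^ (1 / 4 : ℝ) := by positivity
      gcongr
      linarith
    linarith
  refine ⟨hfirst, fun hβ => hfirst.trans (measureReal_mono fun z hz hA2 => (hz hA2).trans ?_)⟩
  have := mul_le_mul_of_nonneg_left hβ hD₄.le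
  linarith
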